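/- Let $k\ge 2$ be an integer. For each prime $p$ and each $1\le j\le k$ let $\mathcal G_j(p)$ be a random variable with $\mathbb P(\mathcal G_j(p)=m)=(1-\frac1p)p^{-m}$ for all integers $m\ge 0$, all these variables being independent. Put $$R_k=\prod_{p}p^{\max_{j\le k}\mathcal G_j(p)-\sum_{j\le k}\mathcal G_j(p)},\qquad p_k(n)=\mathbb P\left(R_k=\tfrac1n\right)\quad(n\ge 1).$$ (i) For every integer $n\ge1$, $$p_k(n)=\prod_{p}\ \sum_{\substack{y_1+\cdots+y_{k-1}=e_p\\ y_i\ge 0}}\left(1-\frac1p\right)^{k-1}\frac1{p^{e_p}}\left(\frac{k-i_1(\mathbf y)}{p^{M(\mathbf y)}}+\frac{i_1(\mathbf y)}{p^{M(\mathbf y)+1}}\right),$$ where the product is over all primes and converges unconditionally, $e_p\ge 0$ is the exponent of $p$ in $n$, the sum is over $(k-1)$-tuples $\mathbf y$ of nonnegative integers, $M(\mathbf y)=\max_{i\le k-1}y_i$ and $i_1(\mathbf y)=\max\{i\le k-1: y_i=M(\mathbf y)\}$. (ii) For every real $t$ with $0<t\le 1$ there is a constant $C=C(k,t)$ such that for every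 integer $x\ge 2$, if $X_1,\dots,X_k$ are independent and uniformly distributed on $\{1,\dots,x\}$, then $$\left|\,\mathbb P\left(\frac{\operatorname{lcm}(X_1,\dots,X_k)}{x^k}>t\right)-\sum_{1\le n\le 1/t}\left(\int_{nt}^1\frac{(-\log z)^{k-1}}{(k-1)!}\,dz\right)p_k(n)\right|\le C\,\frac{\log^{k-1}x}{x}.$$ -/

import Mathlib

open MeasureTheory ProbabilityTheory

namespace LcmTuples

noncomputable section

/-- The parameter `1 - 1/p` (success probability) of the geometric law attached to a prime `p`. -/
def successProb (p : Nat.Primes) : unitInterval :=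
  ⟨1 - 1 / (p : ℝ), by
    have h : (1 : ℝ) ≤ (p : ℝ) := by exact_mod_cast p.2.one_lt.le
    have h1 : 1 / (p : ℝ) ≤ 1 := by
      rw [div_le_one (by linarith)]; exact h
    have h2 : 0 ≤ 1 / (p : ℝ) := by positivity
    exact ⟨by linarith, by linarith⟩⟩

/-- The law of `𝒢ⱼ(p)` on `ℕ`: the value `m` has probability `(1 - 1/p) * (1/p)^m`. -/
def geomLaw (p : Nat.Primes) : Measure ℕ :=
  geometricMeasure (successProb p)

/-- The joint law of all the variables `𝒢ⱼ(p)` (`p` prime, `j` in `Fin k`), which are mutually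
independent. A point `g` of the sample space gives the values `g p j` of `𝒢ⱼ(p)`. -/
def jointLaw (k : ℕ) : Measure (Nat.Primes → Fin k → ℕ) :=
  Measure.infinitePi fun p : Nat.Primes => Measure.pi fun _ : Fin k => geomLaw p

/-- The random variable `R_k = ∏_p p ^ (max_j 𝒢ⱼ(p) - ∑_j 𝒢ⱼ(p))`. All factors lie in `(0, 1]`, so
the infinite product of reals always converges (to `0` if infinitely many factors are not `1`). -/
def R (k : ℕ) (g : Nat.Primes → Fin k → ℕ) : ℝ :=
  ∏' p : Nat.Primes,
    ((p : ℕ) : ℝ) ^ (((Finset.univ.sup (g p) : ℕ) : ℤ) - ((∑ j, g p j : ℕ) : ℤ))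

/-- `p_k(n)`, the probability that `R_k = 1/n`. -/
def pk (k n : ℕ) : ℝ :=
  (jointLaw k).real {g | R k g = 1 / (n : ℝ)}

/-- The largest position `i` in `{1, …, d}` at which the tuple `y = (y_1, …, y_d)` takes its
maximal value (`y_i` being `y` at the index `i - 1` of `Fin d`). -/
def lastMaxPos {d : ℕ} (y : Fin d → ℕ) : ℕ :=
  (Finset.univ.filter fun i => y i = Finset.univ.sup y).sup fun i => (i : ℕ) + 1

/-- The factor of the Euler product of `p_k(n)` at a prime `p` with `p ^ e` exactly dividing `n`.
The sum is over all tuples of `k - 1` nonnegative integers with sum `e`. -/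
def eulerFactor (k p e : ℕ) : ℝ :=
  ∑ y ∈ Finset.finAntidiagonal (k - 1) e,
    (1 - 1 / (p : ℝ)) ^ (k - 1) * (1 / (p : ℝ) ^ e) *
      (((k : ℝ) - (lastMaxPos y : ℝ)) / (p : ℝ) ^ (Finset.univ.sup y) +
        (lastMaxPos y : ℝ) / (p : ℝ) ^ (Finset.univ.sup y + 1))

/-- The law of `(X_1, …, X_k)`, independent and uniform on `{1, …, x}`. -/
def uniformTuple (k x : ℕ) : Measure (Fin k → ℕ) :=
  Measure.pi fun _ : Fin k => uniformOn (Set.Icc 1 x)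

/-- The probability that `lcm(X_1, …, X_k) / x^k > t`. -/
def lcmTail (k x : ℕ) (t : ℝ) : ℝ :=
  (uniformTuple k x).real
    {v | ((Finset.univ.lcm v : ℕ) : ℝ) / (x : ℝ) ^ k > t}

end

end LcmTuples

namespace LcmTuples

/-! ### Sums over primes -/

/-! Every tuple satisfies `∏ X i = n * lcm X` for exactly one `n`. The event `lcm X > t * x ^ k`
then reads `∏ X i > n * t * x ^ k`, which forces `n * t < 1`. For fixed `n` the equation splits into
conditions `∑ v_p(X i) = e_p + max v_p(X i)`, one for each prime; with geometric variables in place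
of valuations, these conditions describe `R_k = 1/n`.

Such a condition only sees valuations truncated at `e_p + 1`, so its indicator is a finite
combination of indicators of `p ^ a i ∣ X i` (`local_mem_span_orthant`). Expanding over the primes
up to `x + n` reduces the count to points of the lattices `∏ d i ℤ` in a hyperbolic region,
estimated uniformly in `d` by `abs_hypCount_sub_hypVol_le`. Since `P(𝒢 ≥ m) = p ^ (-m)`, the main
terms reassemble into the volume times a product of local probabilities.

The errors `x⁻¹ * ∑ i, ∏ j ≠ i, 1 / d j`, weighted by absolute coefficients, also reassemble into
Euler products (`abs_localCount_sub_le`). For `p > n` the coefficients are `(-1) ^ |a| * (1 - |a|)`,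
where `|a| = ∑ i, a i`. They vanish at `|a| = 1`, so the error factor is at most `1 + (k - 1) / p +
O(1 / p ^ 2)` and Mertens' bound gives `log ^ (k - 1)`. The same vanishing makes the local
probability `1 - O(1 / p ^ 2)`, so truncating the Euler product costs only `O(1 / x)`.

For (i), independence and continuity from above give the product of local probabilities
(`hasProd_localProb`); splitting by the last index of the maximum identifies its factors
(`localProb_eq_eulerFactor`). -/

theorem sum_log_div_prime_le {N : ℕ} (hN : 1 ≤ N) :
    ∑ p ∈ Nat.primesLE N, Real.log p / p ≤ Real.log N + Real.log 4 := by
  have hNpos : (0 : ℝ) < N := by exact_mod_cast hN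
  have hdvd : ∏ p ∈ Nat.primesLE N, p ^ (N / p) ∣ N.factorial := by
    apply Finset.prod_dvd_of_isRelPrime
    · intro p hp q hq hpq
      have hp' := (Nat.mem_primesLE.1 hp).2
      have hq' := (Nat.mem_primesLE.1 hq).2
      exact Nat.coprime_iff_isRelPrime.1
        (Nat.Coprime.pow _ _ ((Nat.coprime_primes hp' hq').2 hpq))
    · intro p hp
      have hp' := (Nat.mem_primesLE.1 hp).2
      rw [hp'.pow_dvd_factorial_iff (Nat.lt_succ_self (Nat.log p N))]
      have h1 : 1 ∈ Finset.Ico 1 (Nat.log p N + 1) := by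
        have := Nat.log_pos hp'.one_lt (Nat.mem_primesLE.1 hp).1
        exact Finset.mem_Ico.2 ⟨le_rfl, by omega⟩
      calc N / p = N / p ^ 1 := by simp
        _ ≤ _ := Finset.single_le_sum (f := fun i => N / p ^ i) (fun _ _ => Nat.zero_le _) h1
  have hle : ∑ p ∈ Nat.primesLE N, ((N / p : ℕ) : ℝ) * Real.log p ≤ N * Real.log N := by
    have h1 : (∏ p ∈ Nat.primesLE N, p ^ (N / p)) ≤ N ^ N :=
      (Nat.le_of_dvd (Nat.factorial_pos _) hdvd).trans (Nat.factorial_le_pow _)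
    have h2 : (∏ p ∈ Nat.primesLE N, (p : ℝ) ^ (N / p)) ≤ (N : ℝ) ^ N := by exact_mod_cast h1
    have hne : ∀ p ∈ Nat.primesLE N, (p : ℝ) ^ (N / p) ≠ 0 := fun p hp =>
      pow_ne_zero _ (by exact_mod_cast (Nat.mem_primesLE.1 hp).2.ne_zero)
    have h3 := Real.log_le_log (Finset.prod_pos fun p hp =>
      lt_of_le_of_ne (by positivity) (hne p hp).symm) h2
    rw [Real.log_prod hne, Real.log_pow] at h3
    simpa [Real.log_pow] using h3
  have htheta : ∑ p ∈ Nat.primesLE N, Real.log p ≤ Real.log 4 * N := by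
    rw [← Chebyshev.theta_eq_sum_primesLE_log]
    exact Chebyshev.theta_le_log4_mul_x hNpos.le
  have hkey : N * ∑ p ∈ Nat.primesLE N, Real.log p / p ≤ N * (Real.log N + Real.log 4) := by
    -- Replacing `⌊N / p⌋` by `N / p` costs at most `log p` per prime, in total Chebyshev's `θ(N) ≤
    -- N log 4`.
    have h4 : N * ∑ p ∈ Nat.primesLE N, Real.log p / p ≤
        ∑ p ∈ Nat.primesLE N, (((N / p : ℕ) : ℝ) * Real.log p + Real.log p) := by
      rw [Finset.mul_sum]
      refine Finset.sum_le_sum fun p hp => ?_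
      have hfl : (N : ℝ) / p ≤ ((N / p : ℕ) : ℝ) + 1 := by
        rw [← Nat.floor_div_eq_div (K := ℝ)]
        exact (Nat.lt_floor_add_one _).le
      have hlog : 0 ≤ Real.log p := Real.log_natCast_nonneg p
      calc (N : ℝ) * (Real.log p / p) = N / p * Real.log p := by ring
        _ ≤ (((N / p : ℕ) : ℝ) + 1) * Real.log p := by gcongr
        _ = _ := by ring
    rw [Finset.sum_add_distrib] at h4
    linarith
  exact le_of_mul_le_mul_left hkey hNpos

theorem primesLE_succ_sum (F : ℕ → ℝ) (N : ℕ) :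
    ∑ p ∈ Nat.primesLE (N + 1), F p =
      ∑ p ∈ Nat.primesLE N, F p + if (N + 1).Prime then F (N + 1) else 0 := by
  have : ∀ M, Nat.primesLE M = (Finset.range (M + 1)).filter Nat.Prime := fun M => by
    ext p; simp [Nat.mem_primesLE]
  rw [this, this, Finset.sum_filter, Finset.sum_filter, Finset.sum_range_succ]

theorem sum_inv_prime_le {N : ℕ} (hN : 2 ≤ N) :
    ∑ p ∈ Nat.primesLE N, (1 : ℝ) / p ≤
      Real.log (Real.log N) + (2 + 2 * (Real.log 4 / Real.log 2) - Real.log (Real.log 2)) := by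
  set A : ℕ → ℝ := fun N => ∑ p ∈ Nat.primesLE N, Real.log p / p with hA
  set S : ℕ → ℝ := fun N => ∑ p ∈ Nat.primesLE N, (1 : ℝ) / p with hS
  have hlog : ∀ M : ℕ, 2 ≤ M → 0 < Real.log M := fun M hM =>
    Real.log_pos (by exact_mod_cast (by omega : 1 < M))
  have h4 : 0 ≤ Real.log 4 := Real.log_nonneg (by norm_num)
  have hA0 : ∀ M, 0 ≤ A M := fun M => Finset.sum_nonneg fun p _ =>
    div_nonneg (Real.log_natCast_nonneg p) (by positivity)
  -- Partial summation written as a monotone quantity: the increment of `A M / log M` absorbs that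
  -- of `S`, and the remaining drift is controlled by the bound on `A M` and by `1 - u ≤ -log u`.
  have hmono : ∀ M : ℕ, 2 ≤ M →
      S M - A M / Real.log M - Real.log (Real.log M) + Real.log 4 / Real.log M ≤
      S 2 - A 2 / Real.log (2 : ℕ) - Real.log (Real.log (2 : ℕ)) + Real.log 4 / Real.log (2 : ℕ) := by
    intro M hM
    induction M, hM using Nat.le_induction with
    | base => exact le_rfl
    | succ M hM ih =>
      refine le_trans ?_ ih
      have l1 := hlog M hM
      have l2 := hlog (M + 1) (by omega)
      have l3 : Real.log M ≤ Real.log (M + 1 : ℕ) :=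
        Real.log_le_log (by positivity) (by push_cast; linarith)
      have hstep : S (M + 1) - A (M + 1) / Real.log (M + 1 : ℕ) =
          S M - A M / Real.log (M + 1 : ℕ) := by
        simp only [hS, hA, primesLE_succ_sum]
        split_ifs
        · field_simp
          ring
        · simp
      have hAM := sum_log_div_prime_le (N := M) (by omega)
      change A M ≤ _ at hAM
      have hinv : 0 ≤ 1 / Real.log M - 1 / Real.log (M + 1 : ℕ) := by
        rw [sub_nonneg]; exact one_div_le_one_div_of_le l1 l3
      have h5 := mul_le_mul_of_nonneg_right hAM hinv
      have h6 : 1 - Real.log M / Real.log (M + 1 : ℕ) ≤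
          Real.log (Real.log (M + 1 : ℕ)) - Real.log (Real.log M) := by
        have := Real.log_le_sub_one_of_pos (div_pos l1 l2)
        rw [Real.log_div l1.ne' l2.ne'] at this
        linarith
      have h7 : (Real.log M + Real.log 4) * (1 / Real.log M - 1 / Real.log (M + 1 : ℕ)) =
          1 - Real.log M / Real.log (M + 1 : ℕ) + Real.log 4 / Real.log M -
            Real.log 4 / Real.log (M + 1 : ℕ) := by
        field_simp
        ring
      have h8 : A M * (1 / Real.log M - 1 / Real.log (M + 1 : ℕ)) =
          A M / Real.log M - A M / Real.log (M + 1 : ℕ) := by ring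
      linarith
  have h := hmono N hN
  have hlN := hlog N hN
  have hl2 : 0 < Real.log 2 := Real.log_pos (by norm_num)
  have hl2N : Real.log 2 ≤ Real.log N := Real.log_le_log (by norm_num) (by exact_mod_cast hN)
  have hS2 : S 2 ≤ 1 := by
    have : Nat.primesLE 2 = {2} := by decide
    simp [hS, this]; norm_num
  have hAN : A N / Real.log N ≤ 1 + Real.log 4 / Real.log 2 := by
    have h9 := sum_log_div_prime_le (N := N) (by omega)
    change A N ≤ _ at h9
    calc A N / Real.log N ≤ (Real.log N + Real.log 4) / Real.log N := by gcongr
      _ = 1 + Real.log 4 / Real.log N := by field_simp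
      _ ≤ _ := by gcongr
  have hA2 : 0 ≤ A 2 / Real.log (2 : ℕ) := div_nonneg (hA0 2) (hlog 2 le_rfl).le
  have h10 : 0 ≤ Real.log 4 / Real.log N := by positivity
  push_cast at h hA2
  change S N ≤ _
  linarith

/-- Mertens' upper bound for the product of `1 + 1 / p` over the primes up to `N`. -/
theorem exists_prod_one_add_inv_prime_le :
    ∃ C : ℝ, 0 < C ∧ ∀ N : ℕ, 2 ≤ N →
      ∏ p ∈ Nat.primesLE N, (1 + (1 : ℝ) / p) ≤ C * Real.log N := by
  refine ⟨_, Real.exp_pos (2 + 2 * (Real.log 4 / Real.log 2) - Real.log (Real.log 2)),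
    fun N hN => ?_⟩
  have hl : 0 < Real.log N := Real.log_pos (by exact_mod_cast (by omega : 1 < N))
  calc ∏ p ∈ Nat.primesLE N, (1 + (1 : ℝ) / p)
      ≤ ∏ p ∈ Nat.primesLE N, Real.exp (1 / p) :=
        Finset.prod_le_prod (fun _ _ => by positivity) fun p _ => by
          rw [add_comm]; exact Real.add_one_le_exp _
    _ = Real.exp (∑ p ∈ Nat.primesLE N, (1 : ℝ) / p) := (Real.exp_sum _ _).symm
    _ ≤ Real.exp (Real.log (Real.log N) +
        (2 + 2 * (Real.log 4 / Real.log 2) - Real.log (Real.log 2))) :=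
        Real.exp_le_exp.2 (sum_inv_prime_le hN)
    _ = _ := by rw [Real.exp_add, Real.exp_log hl, mul_comm]

/-! ### The volume of a hyperbolic region in the unit cube -/

/-- The volume of `{u ∈ [0, 1]^k : ∏ u i > c}`, for `c > 0`. -/
noncomputable def hypVol (k : ℕ) (c : ℝ) : ℝ :=
  if c < 1 then 1 - c * ∑ j ∈ Finset.range k, (-Real.log c) ^ j / (j.factorial : ℝ) else 0

theorem hypVol_of_one_le (k : ℕ) {c : ℝ} (hc : 1 ≤ c) : hypVol k c = 0 := by
  simp [hypVol, not_lt.2 hc]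

theorem hypVol_nonneg (k : ℕ) {c : ℝ} (hc : 0 < c) : 0 ≤ hypVol k c := by
  unfold hypVol
  split_ifs with h
  · have hl : 0 ≤ -Real.log c := by linarith [Real.log_nonpos hc.le h.le]
    -- The sum is a Taylor polynomial of `exp` at `-log c ≥ 0`, hence at most `1 / c`.
    have h1 := Real.sum_le_exp_of_nonneg hl k
    rw [Real.exp_neg, Real.exp_log hc] at h1
    have h2 := mul_le_mul_of_nonneg_left h1 hc.le
    rw [mul_inv_cancel₀ hc.ne'] at h2
    linarith
  · exact le_rfl

theorem hypVol_le_one (k : ℕ) {c : ℝ} (hc : 0 < c) : hypVol k c ≤ 1 := by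
  unfold hypVol
  split_ifs with h
  · have hl : 0 ≤ -Real.log c := by linarith [Real.log_nonpos hc.le h.le]
    have : 0 ≤ c * ∑ j ∈ Finset.range k, (-Real.log c) ^ j / (j.factorial : ℝ) := by positivity
    linarith
  · exact zero_le_one

theorem hypVol_zero (c : ℝ) : hypVol 0 c = if c < 1 then 1 else 0 := by simp [hypVol]

theorem hypVol_succ_of_le_one (k : ℕ) {c : ℝ} (hc1 : c ≤ 1) :
    hypVol (k + 1) c =
      1 - c * ∑ j ∈ Finset.range (k + 1), (-Real.log c) ^ j / (j.factorial : ℝ) := by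
  unfold hypVol
  split_ifs with h
  · rfl
  · obtain rfl : c = 1 := le_antisymm hc1 (not_lt.1 h)
    simp [Finset.sum_range_succ']

/-- The derivatives of the terms `c * (-log c) ^ j / j!` telescope, leaving only the top one. -/
theorem hasDerivAt_hypVol_formula (k : ℕ) {c : ℝ} (hc : 0 < c) :
    HasDerivAt (fun c : ℝ =>
      1 - c * ∑ j ∈ Finset.range (k + 1), (-Real.log c) ^ j / (j.factorial : ℝ))
      (-((-Real.log c) ^ k / (k.factorial : ℝ))) c := by
  induction k with
  | zero => simpa using (hasDerivAt_id c).const_sub 1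
  | succ k ih =>
    have h1 : HasDerivAt (fun c : ℝ => c * ((-Real.log c) ^ (k + 1) / ((k + 1).factorial : ℝ)))
        ((-Real.log c) ^ (k + 1) / ((k + 1).factorial : ℝ) -
          (-Real.log c) ^ k / (k.factorial : ℝ)) c := by
      have h2 := ((((Real.hasDerivAt_log hc.ne').neg).pow (k + 1)).div_const
        ((k + 1).factorial : ℝ))
      have h3 := (hasDerivAt_id c).mul h2
      refine h3.congr_deriv ?_
      simp only [id, Nat.factorial_succ, Nat.cast_mul, Pi.neg_apply, Pi.pow_apply,
        Nat.add_sub_cancel]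
      have : (k.factorial : ℝ) ≠ 0 := by exact_mod_cast k.factorial_ne_zero
      field_simp
      push_cast
      ring
    refine ((ih.sub h1).congr_deriv (by ring)).congr_of_eventuallyEq
      (Filter.Eventually.of_forall fun y => ?_)
    simp only [Finset.sum_range_succ _ (k + 1), Pi.sub_apply]
    ring

theorem hypVol_succ_antitoneOn (k : ℕ) : AntitoneOn (hypVol (k + 1)) (Set.Ioc 0 1) := by
  have h : AntitoneOn (fun c : ℝ =>
      1 - c * ∑ j ∈ Finset.range (k + 1), (-Real.log c) ^ j / (j.factorial : ℝ))
      (Set.Ioc 0 1) := by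
    refine antitoneOn_of_deriv_nonpos (convex_Ioc 0 1) ?_ ?_ ?_
    · exact fun c hc => (hasDerivAt_hypVol_formula k hc.1).continuousAt.continuousWithinAt
    · exact fun c hc => (hasDerivAt_hypVol_formula k
        (interior_subset hc).1).differentiableAt.differentiableWithinAt
    · intro c hc
      have hc' := interior_subset hc
      rw [(hasDerivAt_hypVol_formula k hc'.1).deriv]
      have hl : 0 ≤ -Real.log c := by linarith [Real.log_nonpos hc'.1.le hc'.2]
      have : 0 ≤ (-Real.log c) ^ k / (k.factorial : ℝ) := by positivity
      linarith
  exact h.congr fun c hc => (hypVol_succ_of_le_one k hc.2).symm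

theorem hypVol_antitoneOn (k : ℕ) : AntitoneOn (hypVol k) (Set.Ioi 0) := by
  intro a ha b hb hab
  rcases le_or_gt 1 b with h1 | h1
  · rw [hypVol_of_one_le k h1]; exact hypVol_nonneg k ha
  · cases k with
    | zero => rw [hypVol_zero, hypVol_zero, if_pos h1, if_pos (hab.trans_lt h1)]
    | succ k => exact hypVol_succ_antitoneOn k ⟨ha, hab.trans h1.le⟩ ⟨hb, h1.le⟩ hab

theorem hypVol_eq_integral (k : ℕ) {c : ℝ} (hc : 0 < c) (hc1 : c ≤ 1) :
    ∫ z in c..1, (-Real.log z) ^ k / (k.factorial : ℝ) = hypVol (k + 1) c := by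
  have hpos : ∀ z ∈ Set.uIcc c 1, 0 < z := fun z hz => by
    rw [Set.uIcc_of_le hc1] at hz; exact hc.trans_le hz.1
  have h := intervalIntegral.integral_eq_sub_of_hasDerivAt (a := c) (b := 1)
    (fun z hz => (hasDerivAt_hypVol_formula k (hpos z hz)).neg) (by
      apply ContinuousOn.intervalIntegrable
      intro z hz
      have := (hpos z hz).ne'
      apply ContinuousAt.continuousWithinAt
      fun_prop (disch := assumption))
  simp only [neg_neg] at h
  rw [h, hypVol_succ_of_le_one k hc1]
  simp [Finset.sum_range_succ']

/-- Slicing the hyperbolic region along one coordinate. -/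
theorem integral_hypVol_div (k : ℕ) {c : ℝ} (hc : 0 < c) (hc1 : c ≤ 1) :
    ∫ u in c..1, hypVol k (c / u) = hypVol (k + 1) c := by
  have hpos : ∀ z ∈ Set.uIcc c 1, 0 < z := fun z hz => by
    rw [Set.uIcc_of_le hc1] at hz; exact hc.trans_le hz.1
  set F : ℕ → ℝ → ℝ := fun k c =>
    1 - c * ∑ j ∈ Finset.range k, (-Real.log c) ^ j / (j.factorial : ℝ) with hF
  have hcongr : ∫ u in c..1, hypVol k (c / u) = ∫ u in c..1, F k (c / u) := by
    apply intervalIntegral.integral_congr_ae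
    refine Filter.Eventually.of_forall fun u hu => ?_
    rw [Set.uIoc_of_le hc1] at hu
    simp [hypVol, hF, (div_lt_one (hc.trans hu.1)).2 hu.1]
  -- With `y = c / u`, the product rule gives `F (k + 1) y + y * (-log y) ^ k / k!`, which is `F k
  -- y`. At `u = c` the antiderivative vanishes because `F (k + 1) 1 = 0`.
  have hderiv : ∀ u ∈ Set.uIcc c 1,
      HasDerivAt (fun u => u * F (k + 1) (c / u)) (F k (c / u)) u := by
    intro u hu
    have hu0 := hpos u hu
    have h1 : HasDerivAt (fun u => c / u) (-c / u ^ 2) u := by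
      exact ((hasDerivAt_const u c).div (hasDerivAt_id' u) hu0.ne').congr_deriv (by simp)
    have h2 := (hasDerivAt_id u).mul
      ((hasDerivAt_hypVol_formula k (div_pos hc hu0)).comp u h1)
    refine h2.congr_deriv ?_
    simp only [hF, Finset.sum_range_succ, id]
    simp only [Function.comp]
    field_simp
    ring
  rw [hcongr, intervalIntegral.integral_eq_sub_of_hasDerivAt hderiv]
  · have hcc : F (k + 1) (c / c) = 0 := by
      rw [div_self hc.ne']; simp [hF, Finset.sum_range_succ']
    rw [hcc, hypVol_succ_of_le_one k hc1]
    simp [hF]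
  · apply ContinuousOn.intervalIntegrable
    intro z hz
    have hz0 := (hpos z hz).ne'
    have hz1 := (div_pos hc (hpos z hz)).ne'
    apply ContinuousAt.continuousWithinAt
    simp only [hF]
    fun_prop (disch := assumption)

/-! ### Counting lattice points in a hyperbolic region -/

/-- Left and right sums over the full steps bracket the integral and differ by at most one step; the
leftover interval is shorter than one step. Nothing requires `d ≤ x`: for larger `d` the sum is
empty and the bound trivial. This matters because the moduli of the expansion can exceed `x`. -/
theorem abs_riemann_sum_sub_integral_le {g : ℝ → ℝ} (hg : MonotoneOn g (Set.Icc 0 1))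
    (h0 : ∀ u ∈ Set.Icc (0 : ℝ) 1, 0 ≤ g u) (h1 : ∀ u ∈ Set.Icc (0 : ℝ) 1, g u ≤ 1)
    {d x : ℕ} (hd : 0 < d) (hx : 0 < x) :
    |(d / x : ℝ) * ∑ m ∈ Finset.range (x / d), g (d / x * ((m + 1 : ℕ) : ℝ)) -
      ∫ u in (0 : ℝ)..1, g u| ≤ d / x := by
  set δ : ℝ := d / x with hδ
  set M := x / d with hM
  have hd' : (0 : ℝ) < d := by exact_mod_cast hd
  have hx' : (0 : ℝ) < x := by exact_mod_cast hx
  have hδ0 : 0 < δ := by positivity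
  have hs1 : δ * M ≤ 1 := by
    rw [hδ, div_mul_eq_mul_div, div_le_one hx']
    exact_mod_cast Nat.mul_div_le x d
  have hs2 : 1 - δ * M ≤ δ := by
    have : (x : ℝ) ≤ d * M + d := by
      have := (Nat.lt_mul_div_succ x hd).le
      rw [← hM] at this
      exact_mod_cast (by linarith : x ≤ d * M + d)
    have h2 : 1 ≤ (d * M + d) / (x : ℝ) := by rwa [one_le_div hx']
    have h3 : (d * M + d) / (x : ℝ) = δ * M + δ := by rw [hδ]; ring
    linarith
  have hmem : ∀ t : ℝ, 0 ≤ t → t ≤ M → δ * t ∈ Set.Icc (0 : ℝ) 1 := fun t ht ht' =>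
    ⟨by positivity, (mul_le_mul_of_nonneg_left ht' hδ0.le).trans hs1⟩
  have hG : MonotoneOn (fun t => g (δ * t)) (Set.Icc 0 (0 + (M : ℝ))) := by
    intro a ha b hb hab
    rw [zero_add] at ha hb
    exact hg (hmem a ha.1 ha.2) (hmem b hb.1 hb.2) (mul_le_mul_of_nonneg_left hab hδ0.le)
  have hint : δ * ∫ t in (0 : ℝ)..(M : ℝ), g (δ * t) = ∫ u in (0 : ℝ)..δ * M, g u := by
    rw [intervalIntegral.integral_comp_mul_left _ hδ0.ne']
    simp [hδ0.ne']
  have hA := hG.integral_le_sum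
  have hB := hG.sum_le_integral
  simp only [zero_add] at hA hB
  have hA' := mul_le_mul_of_nonneg_left hA hδ0.le
  have hB' := mul_le_mul_of_nonneg_left hB hδ0.le
  rw [hint] at hA' hB'
  have hshift : ∑ m ∈ Finset.range M, g (δ * ((m + 1 : ℕ) : ℝ)) ≤
      ∑ m ∈ Finset.range M, g (δ * (m : ℝ)) + 1 := by
    have e1 := Finset.sum_range_succ (fun m : ℕ => g (δ * (m : ℝ))) M
    have e2 := Finset.sum_range_succ' (fun m : ℕ => g (δ * (m : ℝ))) M
    have e3 := h1 _ (hmem M (by positivity) le_rfl)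
    have e4 := h0 _ (hmem 0 le_rfl (by positivity))
    simp only [Nat.cast_zero] at e2
    linarith
  have hshift' := mul_le_mul_of_nonneg_left hshift hδ0.le
  have hs0 : 0 ≤ δ * M := by positivity
  have hi : ∀ a b : ℝ, 0 ≤ a → a ≤ b → b ≤ 1 → IntervalIntegrable g volume a b :=
    fun a b ha hab hb => (hg.mono (by
      rw [Set.uIcc_of_le hab]; exact Set.Icc_subset_Icc ha hb)).intervalIntegrable
  have hsplit := intervalIntegral.integral_add_adjacent_intervals
    (hi 0 (δ * M) le_rfl hs0 hs1) (hi (δ * M) 1 hs0 hs1 le_rfl)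
  have hrest0 : 0 ≤ ∫ u in (δ * M)..1, g u :=
    intervalIntegral.integral_nonneg hs1 fun u hu => h0 u ⟨hs0.trans hu.1, hu.2⟩
  have hrest1 : ∫ u in (δ * M)..1, g u ≤ 1 - δ * M := by
    have := intervalIntegral.integral_mono_on hs1 (hi (δ * M) 1 hs0 hs1 le_rfl)
      (intervalIntegrable_const (c := (1 : ℝ))) fun u hu => h1 u ⟨hs0.trans hu.1, hu.2⟩
    simpa using this
  rw [abs_le]
  constructor <;> linarith

theorem sum_piFinset_succ {k : ℕ} (s : Finset ℕ) (F : (Fin (k + 1) → ℕ) → ℝ) :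
    ∑ X ∈ Fintype.piFinset (fun _ : Fin (k + 1) => s), F X =
      ∑ a ∈ s, ∑ Y ∈ Fintype.piFinset (fun _ : Fin k => s), F (Fin.cons a Y) := by
  rw [← Finset.sum_product']
  refine Finset.sum_nbij' (fun X => (X 0, Fin.tail X)) (fun z => Fin.cons z.1 z.2) ?_ ?_ ?_ ?_ ?_
  · intro X hX
    simp only [Fintype.mem_piFinset, Finset.mem_product] at hX ⊢
    exact ⟨hX 0, fun i => hX i.succ⟩
  · intro z hz
    simp only [Fintype.mem_piFinset, Finset.mem_product] at hz ⊢
    exact Fin.cases hz.1 hz.2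
  · simp
  · simp
  · simp

theorem sum_Icc_dvd (x : ℕ) {d : ℕ} (hd : 0 < d) (F : ℕ → ℝ) :
    ∑ a ∈ Finset.Icc 1 x, (if d ∣ a then F a else 0) =
      ∑ m ∈ Finset.range (x / d), F (d * (m + 1)) := by
  rw [← Finset.sum_filter]
  symm
  refine Finset.sum_nbij' (fun m => d * (m + 1)) (fun a => a / d - 1) ?_ ?_ ?_ ?_ ?_
  · intro m hm
    simp only [Finset.mem_filter, Finset.mem_Icc, Finset.mem_range] at hm ⊢
    refine ⟨⟨Nat.mul_pos hd (Nat.succ_pos m), ?_⟩, dvd_mul_right _ _⟩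
    exact (Nat.mul_le_mul_left d hm).trans (Nat.mul_div_le x d)
  · intro a ha
    simp only [Finset.mem_filter, Finset.mem_Icc, Finset.mem_range] at ha ⊢
    obtain ⟨⟨h1, h2⟩, b, rfl⟩ := ha
    have hb : 0 < b := Nat.pos_of_mul_pos_left h1
    rw [Nat.mul_div_cancel_left _ hd]
    have : b ≤ x / d := (Nat.le_div_iff_mul_le hd).2 (by linarith)
    omega
  · intro m _
    simp [Nat.mul_div_cancel_left _ hd]
  · intro a ha
    simp only [Finset.mem_filter, Finset.mem_Icc] at ha
    obtain ⟨⟨h1, h2⟩, b, rfl⟩ := ha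
    have hb : 0 < b := Nat.pos_of_mul_pos_left h1
    rw [Nat.mul_div_cancel_left _ hd, Nat.sub_add_cancel hb]
  · simp

/-- The number of `X ∈ {1, …, x}^k` with `d i ∣ X i` for all `i` and `∏ X i > c * x ^ k`. -/
noncomputable def hypCount (k x : ℕ) (d : Fin k → ℕ) (c : ℝ) : ℝ :=
  ∑ X ∈ Fintype.piFinset (fun _ : Fin k => Finset.Icc 1 x),
    if (∀ i, d i ∣ X i) ∧ c * (x : ℝ) ^ k < ∏ i, (X i : ℝ) then 1 else 0

theorem hypCount_succ (k : ℕ) {x : ℕ} (hx : 0 < x) (d : Fin (k + 1) → ℕ) (hd : 0 < d 0) (c : ℝ) :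
    hypCount (k + 1) x d c = ∑ m ∈ Finset.range (x / d 0),
      hypCount k x (Fin.tail d) (c / (d 0 / x * ((m + 1 : ℕ) : ℝ))) := by
  rw [hypCount, sum_piFinset_succ]
  have hd' : (0 : ℝ) < d 0 := by exact_mod_cast hd
  have hx' : (0 : ℝ) < x := by exact_mod_cast hx
  have hterm : ∀ a ∈ Finset.Icc 1 x,
      (∑ Y ∈ Fintype.piFinset (fun _ : Fin k => Finset.Icc 1 x),
        if (∀ i, d i ∣ (Fin.cons a Y : Fin (k + 1) → ℕ) i) ∧
          c * (x : ℝ) ^ (k + 1) < ∏ i, (((Fin.cons a Y : Fin (k + 1) → ℕ) i : ℕ) : ℝ)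
        then (1 : ℝ) else 0) =
      if d 0 ∣ a then hypCount k x (Fin.tail d) (c / (a / x)) else 0 := by
    intro a ha
    have ha' : (0 : ℝ) < a := by exact_mod_cast (Finset.mem_Icc.1 ha).1
    split_ifs with h
    · refine Finset.sum_congr rfl fun Y _ => ?_
      have : c / (a / x) * (x : ℝ) ^ k = c * (x : ℝ) ^ (k + 1) / a := by
        field_simp
        ring
      simp only [Fin.forall_fin_succ, Fin.prod_univ_succ, Fin.cons_zero, Fin.cons_succ, h,
        true_and, this, div_lt_iff₀ ha', Fin.tail, mul_comm (a : ℝ)]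
    · exact Finset.sum_eq_zero fun Y _ => if_neg fun h' => h (by simpa using h'.1 0)
  rw [Finset.sum_congr rfl hterm,
    sum_Icc_dvd x hd fun a => hypCount k x (Fin.tail d) (c / (a / x))]
  refine Finset.sum_congr rfl fun m _ => ?_
  push_cast
  congr 2
  ring

/-- The guard `0 < u` restores monotonicity at the endpoint, where the convention `c / 0 = 0` would
give the value `1`. The part `u ≤ c` contributes nothing, which allows integrating over all of `[0,
1]`. -/
theorem integral_indicator_hypVol_div (k : ℕ) {c : ℝ} (hc : 0 < c) :
    ∫ u in (0 : ℝ)..1, (if 0 < u then hypVol k (c / u) else 0) = hypVol (k + 1) c := by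
  have hmono : MonotoneOn (fun u : ℝ => if 0 < u then hypVol k (c / u) else 0) (Set.Icc 0 1) := by
    intro a ha b hb hab
    dsimp only
    split_ifs with h1 h2 h2
    · exact hypVol_antitoneOn k (div_pos hc h2) (div_pos hc h1)
        (div_le_div_of_nonneg_left hc.le h1 hab)
    · exact absurd (h1.trans_le hab) h2
    · exact hypVol_nonneg k (div_pos hc h2)
    · exact le_rfl
  have hi : ∀ a b : ℝ, 0 ≤ a → a ≤ b → b ≤ 1 → IntervalIntegrable
      (fun u : ℝ => if 0 < u then hypVol k (c / u) else 0) volume a b :=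
    fun a b ha hab hb => (hmono.mono (by
      rw [Set.uIcc_of_le hab]; exact Set.Icc_subset_Icc ha hb)).intervalIntegrable
  have hzero : ∀ b : ℝ, 0 ≤ b → b ≤ c →
      ∫ u in (0 : ℝ)..b, (if 0 < u then hypVol k (c / u) else 0) = 0 := by
    intro b hb hbc
    apply intervalIntegral.integral_zero_ae
    refine Filter.Eventually.of_forall fun u hu => ?_
    rw [Set.uIoc_of_le hb] at hu
    rw [if_pos hu.1, hypVol_of_one_le k]
    rw [one_le_div hu.1]
    exact hu.2.trans hbc
  rcases le_or_gt 1 c with h | h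
  · rw [hzero 1 zero_le_one h, hypVol_of_one_le _ h]
  · rw [← intervalIntegral.integral_add_adjacent_intervals (hi 0 c le_rfl hc.le h.le)
      (hi c 1 hc.le h.le le_rfl), hzero c hc.le le_rfl, zero_add, ← integral_hypVol_div k hc h.le]
    apply intervalIntegral.integral_congr_ae
    refine Filter.Eventually.of_forall fun u hu => ?_
    rw [Set.uIoc_of_le h.le] at hu
    rw [if_pos (hc.trans hu.1)]

theorem abs_sum_hypVol_div_sub_le (k : ℕ) {c : ℝ} (hc : 0 < c) {d x : ℕ} (hd : 0 < d)
    (hx : 0 < x) :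
    |(d / x : ℝ) * ∑ m ∈ Finset.range (x / d), hypVol k (c / (d / x * ((m + 1 : ℕ) : ℝ))) -
      hypVol (k + 1) c| ≤ d / x := by
  have hd' : (0 : ℝ) < d := by exact_mod_cast hd
  have hx' : (0 : ℝ) < x := by exact_mod_cast hx
  rw [← integral_indicator_hypVol_div k hc]
  have := abs_riemann_sum_sub_integral_le
    (g := fun u : ℝ => if 0 < u then hypVol k (c / u) else 0) ?_ ?_ ?_ hd hx
  · convert this using 5 with m
    rw [if_pos (by positivity)]
  · intro a ha b hb hab
    dsimp only
    split_ifs with h1 h2 h2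
    · exact hypVol_antitoneOn k (div_pos hc h2) (div_pos hc h1)
        (div_le_div_of_nonneg_left hc.le h1 hab)
    · exact absurd (h1.trans_le hab) h2
    · exact hypVol_nonneg k (div_pos hc h2)
    · exact le_rfl
  · intro u _
    split_ifs with h
    · exact hypVol_nonneg k (div_pos hc h)
    · exact le_rfl
  · intro u _
    split_ifs with h
    · exact hypVol_le_one k (div_pos hc h)
    · exact zero_le_one

/-- The discrepancy of the sublattice `∏ d i ℤ` in a hyperbolic region of the cube `(0, x]^k`. -/
theorem abs_hypCount_sub_hypVol_le (k : ℕ) {c : ℝ} (hc : 0 < c) {x : ℕ} (hx : 0 < x)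
    (d : Fin k → ℕ) (hd : ∀ i, 0 < d i) :
    |(∏ i, (d i / x : ℝ)) * hypCount k x d c - hypVol k c| ≤ ∑ i, (d i / x : ℝ) := by
  induction k generalizing c with
  | zero => simp [hypCount, hypVol_zero]
  | succ k ih =>
    have hd' : (0 : ℝ) < d 0 := by exact_mod_cast hd 0
    have hx' : (0 : ℝ) < x := by exact_mod_cast hx
    have hS0 : (0 : ℝ) ≤ ∑ i : Fin k, (d i.succ / x : ℝ) :=
      Finset.sum_nonneg fun _ _ => by positivity
    rw [hypCount_succ k hx d (hd 0), Fin.prod_univ_succ, Fin.sum_univ_succ]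
    -- Each slice has weight `d 0 / x` and there are `⌊x / d 0⌋` of them, so the total weight is at
    -- most `1` and the inductive error is not amplified. The slice parameter may exceed `1`, hence
    -- the induction over all `c > 0`.
    have h1 : |(d 0 / x : ℝ) * ∑ m ∈ Finset.range (x / d 0),
        ((∏ i : Fin k, (d i.succ / x : ℝ)) *
          hypCount k x (Fin.tail d) (c / (d 0 / x * ((m + 1 : ℕ) : ℝ))) -
          hypVol k (c / (d 0 / x * ((m + 1 : ℕ) : ℝ))))| ≤ ∑ i : Fin k, (d i.succ / x : ℝ) := by
      rw [abs_mul, abs_of_nonneg (by positivity : (0 : ℝ) ≤ d 0 / x)]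
      calc (d 0 / x : ℝ) * |_|
          ≤ d 0 / x * ∑ m ∈ Finset.range (x / d 0), ∑ i : Fin k, (d i.succ / x : ℝ) := by
            refine mul_le_mul_of_nonneg_left ((Finset.abs_sum_le_sum_abs _ _).trans
              (Finset.sum_le_sum fun m _ => ?_)) (by positivity)
            exact ih (by positivity) (Fin.tail d) fun i => hd i.succ
        _ = (d 0 / x * ((x / d 0 : ℕ) : ℝ)) * ∑ i : Fin k, (d i.succ / x : ℝ) := by
            simp [mul_assoc]
        _ ≤ 1 * ∑ i : Fin k, (d i.succ / x : ℝ) := by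
            refine mul_le_mul_of_nonneg_right ?_ hS0
            rw [div_mul_eq_mul_div, div_le_one hx']
            exact_mod_cast Nat.mul_div_le x (d 0)
        _ = _ := one_mul _
    have h2 := abs_sum_hypVol_div_sub_le k hc (hd 0) hx
    rw [Finset.sum_sub_distrib, ← Finset.mul_sum, mul_sub, ← mul_assoc] at h1
    rw [abs_le] at h1 h2 ⊢
    constructor <;> linarith [h1.1, h1.2, h2.1, h2.2]

/-! ### Finite expansions of the local condition `∑ v = e + max v` -/

theorem exists_max_index {k : ℕ} [NeZero k] (v : Fin k → ℕ) : ∃ m, ∀ j, v j ≤ v m := by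
  obtain ⟨m, -, hm⟩ := Finset.exists_max_image Finset.univ v Finset.univ_nonempty
  exact ⟨m, fun j => hm j (Finset.mem_univ j)⟩

theorem sup_eq_of_forall_le {k : ℕ} {v : Fin k → ℕ} {m : Fin k} (hm : ∀ j, v j ≤ v m) :
    Finset.univ.sup v = v m :=
  le_antisymm (Finset.sup_le fun j _ => hm j) (Finset.le_sup (Finset.mem_univ m))

theorem sum_eq_add_sup_iff {k : ℕ} (e : ℕ) {v : Fin k → ℕ} {m : Fin k} (hm : ∀ j, v j ≤ v m) :
    ∑ j, v j = e + Finset.univ.sup v ↔ ∑ j ∈ Finset.univ.erase m, v j = e := by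
  rw [sup_eq_of_forall_le hm, ← Finset.sum_erase_add _ _ (Finset.mem_univ m)]
  omega

/-- After cancelling a maximal coordinate, the others sum to `e`, so each is at most `e` and is
unaffected by truncation at `e + 1`. Truncation also keeps that coordinate maximal. -/
theorem sum_eq_add_sup_iff_min {k : ℕ} (e : ℕ) (v : Fin k → ℕ) :
    ∑ j, v j = e + Finset.univ.sup v ↔
      ∑ j, min (v j) (e + 1) = e + Finset.univ.sup fun j => min (v j) (e + 1) := by
  rcases Nat.eq_zero_or_pos k with rfl | hk
  · simp
  have : NeZero k := ⟨hk.ne'⟩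
  obtain ⟨m, hm⟩ := exists_max_index v
  rw [sum_eq_add_sup_iff e hm, sum_eq_add_sup_iff (v := fun j => min (v j) (e + 1)) e
    fun j => min_le_min_right _ (hm j)]
  have key : ∀ f : Fin k → ℕ, ∑ j ∈ Finset.univ.erase m, f j = e →
      ∀ j ∈ Finset.univ.erase m, f j ≤ e := fun f hf j hj =>
    hf ▸ Finset.single_le_sum (f := f) (fun _ _ => Nat.zero_le _) hj
  constructor
  · intro h
    rw [← h]
    refine Finset.sum_congr rfl fun j hj => ?_
    have := key v h j hj
    rw [h]; omega
  · intro h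
    conv_rhs => rw [← h]
    refine Finset.sum_congr rfl fun j hj => ?_
    have := key _ h j hj
    omega

/-- The indicator function of the orthant above `a`. -/
def orthant {k : ℕ} (a v : Fin k → ℕ) : ℝ := if ∀ i, a i ≤ v i then 1 else 0

theorem orthant_mul {k : ℕ} (a b : Fin k → ℕ) : orthant a * orthant b = orthant (a ⊔ b) := by
  ext v
  simp only [orthant, Pi.mul_apply, Pi.sup_apply, sup_le_iff, forall_and]
  split_ifs <;> simp_all

/-- Orthants are stable under intersection, so their span is closed under products. -/
theorem mul_mem_span_orthant {k : ℕ} {f g : (Fin k → ℕ) → ℝ}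
    (hf : f ∈ Submodule.span ℝ (Set.range (orthant (k := k))))
    (hg : g ∈ Submodule.span ℝ (Set.range (orthant (k := k)))) :
    f * g ∈ Submodule.span ℝ (Set.range (orthant (k := k))) := by
  have h := Submodule.mul_mem_mul hf hg
  rw [Submodule.span_mul_span] at h
  refine Submodule.span_mono ?_ h
  rintro _ ⟨_, ⟨a, rfl⟩, _, ⟨b, rfl⟩, rfl⟩
  exact ⟨a ⊔ b, (orthant_mul a b).symm⟩

theorem prod_mem_span_orthant {k : ℕ} {ι : Type*} (s : Finset ι) (f : ι → (Fin k → ℕ) → ℝ)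
    (hf : ∀ i ∈ s, f i ∈ Submodule.span ℝ (Set.range (orthant (k := k)))) :
    ∏ i ∈ s, f i ∈ Submodule.span ℝ (Set.range (orthant (k := k))) := by
  classical
  induction s using Finset.induction_on with
  | empty =>
    refine Submodule.subset_span ⟨0, ?_⟩
    ext v
    simp [orthant]
  | insert i s hi ih =>
    rw [Finset.prod_insert hi]
    exact mul_mem_span_orthant (hf i (Finset.mem_insert_self i s))
      (ih fun j hj => hf j (Finset.mem_insert_of_mem hj))

theorem orthant_single {k : ℕ} (i : Fin k) (b : ℕ) (v : Fin k → ℕ) :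
    orthant (Pi.single i b) v = if b ≤ v i then 1 else 0 := by
  unfold orthant
  congr 1
  rw [eq_iff_iff]
  refine ⟨fun h => by simpa using h i, fun h j => ?_⟩
  rcases eq_or_ne j i with rfl | hj
  · simpa using h
  · simp [hj]

/-- The indicator depends only on the truncated vector, hence is a finite sum of products of
one-coordinate indicators. Each of these is a difference of two half-line indicators, or a single
one at the top value `e + 1`. -/
theorem local_mem_span_orthant (k e : ℕ) :
    (fun v : Fin k → ℕ => if ∑ j, v j = e + Finset.univ.sup v then (1 : ℝ) else 0) ∈
      Submodule.span ℝ (Set.range (orthant (k := k))) := by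
  have hfac : ∀ (i : Fin k) (b : ℕ), b ∈ Finset.range (e + 2) →
      (fun v : Fin k → ℕ => if min (v i) (e + 1) = b then (1 : ℝ) else 0) ∈
        Submodule.span ℝ (Set.range (orthant (k := k))) := by
    intro i b hb
    rw [Finset.mem_range] at hb
    rcases lt_or_eq_of_le (Nat.lt_succ_iff.1 hb) with h | h
    · have : (fun v : Fin k → ℕ => if min (v i) (e + 1) = b then (1 : ℝ) else 0) =
          orthant (Pi.single i b) - orthant (Pi.single i (b + 1)) := by
        ext v
        simp only [Pi.sub_apply, orthant_single]
        split_ifs <;> first | (exfalso; omega) | norm_num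
      rw [this]
      exact Submodule.sub_mem _ (Submodule.subset_span ⟨_, rfl⟩) (Submodule.subset_span ⟨_, rfl⟩)
    · have : (fun v : Fin k → ℕ => if min (v i) (e + 1) = b then (1 : ℝ) else 0) =
          orthant (Pi.single i b) := by
        ext v
        rw [orthant_single]
        congr 1
        rw [eq_iff_iff]
        omega
      rw [this]
      exact Submodule.subset_span ⟨_, rfl⟩
  have hsum : (fun v : Fin k → ℕ => if ∑ j, v j = e + Finset.univ.sup v then (1 : ℝ) else 0) =
      ∑ b ∈ Fintype.piFinset (fun _ : Fin k => Finset.range (e + 2)),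
        (if ∑ j, b j = e + Finset.univ.sup b then (1 : ℝ) else 0) •
          ∏ i, fun v : Fin k → ℕ => if min (v i) (e + 1) = b i then (1 : ℝ) else 0 := by
    ext v
    rw [Finset.sum_apply, Finset.sum_eq_single (fun j => min (v j) (e + 1))]
    · simp [Finset.prod_apply, sum_eq_add_sup_iff_min e v]
    · intro b _ hb
      obtain ⟨i, hi⟩ := Function.ne_iff.1 hb
      rw [Pi.smul_apply, Finset.prod_apply,
        Finset.prod_eq_zero (Finset.mem_univ i) (if_neg hi.symm), smul_zero]
    · intro h
      exact absurd (Fintype.mem_piFinset.2 fun j => Finset.mem_range.2 (by omega)) h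
  rw [hsum]
  refine Submodule.sum_mem _ fun b hb => Submodule.smul_mem _ _
    (prod_mem_span_orthant _ _ fun i _ => hfac i _ (Fintype.mem_piFinset.1 hb i))

/-- `h`, supported on `A`, expands the indicator function of `∑ v = e + max v` in indicators of orthants. -/
def IsLocalExpansion (k e : ℕ) (A : Finset (Fin k → ℕ)) (h : (Fin k → ℕ) → ℝ) : Prop :=
  ∀ v : Fin k → ℕ, (if ∑ j, v j = e + Finset.univ.sup v then (1 : ℝ) else 0) =
    ∑ a ∈ A, h a * if ∀ i, a i ≤ v i then 1 else 0

theorem exists_isLocalExpansion (k e : ℕ) : ∃ A h, IsLocalExpansion k e A h := by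
  obtain ⟨c, hc⟩ := (Finsupp.mem_span_range_iff_exists_finsupp).1 (local_mem_span_orthant k e)
  refine ⟨c.support, c, fun v => ?_⟩
  rw [← congrFun hc v, Finsupp.sum, Finset.sum_apply]
  rfl

/-- The expansion coefficients in the case `e = 0`. -/
def coprimeCoeff {k : ℕ} (a : Fin k → ℕ) : ℝ := (-1) ^ (∑ i, a i) * (1 - ∑ i, (a i : ℝ))

/-- For `e = 0` the condition says that at most one coordinate is nonzero. -/
theorem indicator_sum_eq_sup {k : ℕ} (v : Fin k → ℕ) :
    (if ∑ j, v j = 0 + Finset.univ.sup v then (1 : ℝ) else 0) =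
      (if ∀ i, v i = 0 then 1 else 0) +
        ∑ l, if v l ≠ 0 ∧ ∀ i, i ≠ l → v i = 0 then (1 : ℝ) else 0 := by
  rcases Nat.eq_zero_or_pos k with rfl | hk
  · simp
  have : NeZero k := ⟨hk.ne'⟩
  obtain ⟨m, hm⟩ := exists_max_index v
  have h0 : (∀ i, v i = 0) ↔ v m = 0 :=
    ⟨fun h => h m, fun h i => Nat.le_zero.1 (h ▸ hm i)⟩
  have h1 : ∀ l, l ≠ m → ¬ (v l ≠ 0 ∧ ∀ i, i ≠ l → v i = 0) := by
    rintro l hl ⟨h2, h3⟩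
    have := hm l
    rw [h3 m hl.symm] at this
    omega
  rw [Finset.sum_eq_single m (fun l _ hl => if_neg (h1 l hl)) (by simp)]
  simp only [h0, sum_eq_add_sup_iff 0 hm, Finset.sum_eq_zero_iff, Finset.mem_erase,
    Finset.mem_univ, and_true]
  by_cases h4 : v m = 0
  · have := h0.2 h4
    simp [h4, this]
  · simp [h4]

/-- Write `I i` for the indicator of `1 ≤ v i`. Expanding `∏ i, (1 - I i)` gives coefficients `(-1)
^ |a|`, and expanding `I l * ∏ i ≠ l, (1 - I i)` gives `-(-1) ^ |a| * a l`. Summing over `l` yields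
`coprimeCoeff`. -/
theorem isLocalExpansion_zero (k : ℕ) :
    IsLocalExpansion k 0 (Fintype.piFinset fun _ => Finset.range 2) coprimeCoeff := by
  intro v
  have hprod : ∀ w : Fin k → ℕ → ℝ,
      ∑ a ∈ Fintype.piFinset (fun _ : Fin k => Finset.range 2),
        ∏ i, (w i (a i) * if a i ≤ v i then 1 else 0) =
      ∏ i, (w i 0 + w i 1 * if 1 ≤ v i then 1 else 0) := by
    intro w
    refine (Finset.prod_univ_sum (fun _ : Fin k => Finset.range 2)
      fun i b => w i b * if b ≤ v i then 1 else 0).symm.trans ?_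
    simp [Finset.sum_range_succ]
  have hall : ∀ a : Fin k → ℕ, (if ∀ i, a i ≤ v i then (1 : ℝ) else 0) =
      ∏ i, if a i ≤ v i then (1 : ℝ) else 0 := fun a => by
    simp [Finset.prod_ite_zero]
  have h1 : ∑ a ∈ Fintype.piFinset (fun _ : Fin k => Finset.range 2),
      (-1 : ℝ) ^ (∑ i, a i) * (if ∀ i, a i ≤ v i then (1 : ℝ) else 0) =
      if ∀ i, v i = 0 then 1 else 0 := by
    have := hprod fun _ b => (-1) ^ b
    simp only [Finset.prod_mul_distrib, Finset.prod_pow_eq_pow_sum, ← hall] at this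
    rw [this]
    have h2 : ∀ i, ((-1 : ℝ) ^ 0 + (-1) ^ 1 * if 1 ≤ v i then 1 else 0) =
        if v i = 0 then 1 else 0 := fun i => by
      split_ifs <;> first | (exfalso; omega) | norm_num
    simp only [h2]
    simp [Finset.prod_ite_zero]
  have h2 : ∀ l, ∑ a ∈ Fintype.piFinset (fun _ : Fin k => Finset.range 2),
      (-1 : ℝ) ^ (∑ i, a i) * (a l : ℝ) * (if ∀ i, a i ≤ v i then (1 : ℝ) else 0) =
      -if v l ≠ 0 ∧ ∀ i, i ≠ l → v i = 0 then 1 else 0 := by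
    intro l
    -- The extra weight `b` at coordinate `l` kills its constant term, leaving `-1` times the
    -- indicator of `1 ≤ v l`.
    have := hprod fun i b => (-1) ^ b * if i = l then (b : ℝ) else 1
    simp only [Finset.prod_mul_distrib, Finset.prod_pow_eq_pow_sum, ← hall] at this
    simp only [Finset.prod_ite_eq', Finset.mem_univ, if_true] at this
    rw [this, ← Finset.mul_prod_erase _ _ (Finset.mem_univ l)]
    have h3 : ∏ i ∈ Finset.univ.erase l, ((-1 : ℝ) ^ 0 * (if i = l then ((0 : ℕ) : ℝ) else 1) +
        (-1) ^ 1 * (if i = l then ((1 : ℕ) : ℝ) else 1) * if 1 ≤ v i then 1 else 0) =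
        ∏ i ∈ Finset.univ.erase l, if v i = 0 then 1 else 0 := by
      refine Finset.prod_congr rfl fun i hi => ?_
      simp only [(Finset.mem_erase.1 hi).1, if_false]
      split_ifs <;> first | (exfalso; omega) | norm_num
    rw [h3]
    simp only [Finset.prod_ite_zero]
    by_cases h4 : v l = 0
    · simp [h4]
    · have : 1 ≤ v l := Nat.one_le_iff_ne_zero.2 h4
      simp only [h4, this, if_true, ne_eq, not_false_eq_true, true_and, Finset.mem_erase,
        Finset.mem_univ, and_true, Finset.prod_const_one]
      split_ifs <;> simp_all
  rw [indicator_sum_eq_sup, ← h1]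
  simp only [← neg_eq_iff_eq_neg] at h2
  simp only [← h2, coprimeCoeff]
  rw [Finset.sum_neg_distrib, Finset.sum_comm, ← sub_eq_add_neg, ← Finset.sum_sub_distrib]
  refine Finset.sum_congr rfl fun a _ => ?_
  rw [← Finset.sum_mul, ← Finset.mul_sum]
  ring

/-! ### Sizes of the coefficients of the local expansions -/

theorem abs_coprimeCoeff {k : ℕ} (a : Fin k → ℕ) : |coprimeCoeff a| = |1 - ∑ i, (a i : ℝ)| := by
  simp [coprimeCoeff, abs_mul]

theorem abs_coprimeCoeff_le {k : ℕ} {a : Fin k → ℕ}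
    (ha : a ∈ Fintype.piFinset fun _ : Fin k => Finset.range 2) : |coprimeCoeff a| ≤ k + 1 := by
  rw [abs_coprimeCoeff]
  have h1 : ∑ i, (a i : ℝ) ≤ k := by
    have : ∑ i, (a i : ℝ) ≤ ∑ _i : Fin k, (1 : ℝ) := Finset.sum_le_sum fun i _ => by
      have := Finset.mem_range.1 (Fintype.mem_piFinset.1 ha i)
      exact_mod_cast Nat.lt_succ_iff.1 this
    simpa using this
  have h0 : 0 ≤ ∑ i, (a i : ℝ) := by positivity
  rw [abs_le]
  constructor <;> linarith

theorem card_piFinset_range_two (k : ℕ) :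
    ((Fintype.piFinset fun _ : Fin k => Finset.range 2).card : ℝ) = 2 ^ k := by simp

/-- This is where the exponent `k - 1` of the logarithm arises. Tuples with `∑ a = 1` have
coefficient `0`, so the terms linear in `q` come only from `a i = a j = 1` with the other entries
zero: `k - 1` choices of `j`, each with coefficient of absolute value `1`. -/
theorem sum_abs_coprimeCoeff_le {k : ℕ} (i : Fin k) {q : ℝ} (hq0 : 0 ≤ q) (hq1 : q ≤ 1) :
    ∑ a ∈ Fintype.piFinset (fun _ : Fin k => Finset.range 2),
      |coprimeCoeff a| * q ^ (∑ j ∈ Finset.univ.erase i, a j) ≤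
      1 + (k - 1 : ℕ) * q + 2 ^ k * (k + 1) * q ^ 2 := by
  classical
  have hterm : ∀ a ∈ Fintype.piFinset (fun _ : Fin k => Finset.range 2),
      |coprimeCoeff a| * q ^ (∑ j ∈ Finset.univ.erase i, a j) ≤
      (if a = 0 then 1 else 0) +
        (∑ j ∈ Finset.univ.erase i, if a = Pi.single i 1 + Pi.single j 1 then q else 0) +
        (k + 1) * q ^ 2 := by
    intro a ha
    have hle : ∀ j, a j ≤ 1 := fun j =>
      Nat.lt_succ_iff.1 (Finset.mem_range.1 (Fintype.mem_piFinset.1 ha j))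
    set B := ∑ j ∈ Finset.univ.erase i,
      if a = Pi.single i 1 + Pi.single j 1 then q else 0 with hBdef
    have hB : 0 ≤ B :=
      Finset.sum_nonneg fun j _ => by split_ifs <;> simp [hq0]
    have hC : 0 ≤ ((k : ℝ) + 1) * q ^ 2 := by positivity
    have hA : (0 : ℝ) ≤ if a = 0 then 1 else 0 := by split_ifs <;> simp
    have hsplit : (∑ j, (a j : ℝ)) = a i + ((∑ j ∈ Finset.univ.erase i, a j : ℕ) : ℝ) := by
      rw [← Finset.add_sum_erase _ _ (Finset.mem_univ i)]
      push_cast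
      rfl
    set s := ∑ j ∈ Finset.univ.erase i, a j with hs
    have hi : a i = 0 ∨ a i = 1 := by have := hle i; omega
    rcases (by omega : s = 0 ∨ s = 1 ∨ 2 ≤ s) with h | h | h
    · rcases hi with hi | hi
      · have ha0 : a = 0 := by
          ext j
          rcases eq_or_ne j i with rfl | hj
          · exact hi
          · exact Finset.sum_eq_zero_iff.1 (hs ▸ h) j
              (Finset.mem_erase.2 ⟨hj, Finset.mem_univ j⟩)
        rw [abs_coprimeCoeff, hsplit, h, hi, if_pos ha0]
        norm_num
        linarith
      · rw [abs_coprimeCoeff, hsplit, h, hi]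
        norm_num
        linarith
    · rcases hi with hi | hi
      · rw [abs_coprimeCoeff, hsplit, h, hi]
        norm_num
        linarith
      · obtain ⟨j, hj, hj0⟩ : ∃ j ∈ Finset.univ.erase i, a j ≠ 0 := by
          by_contra! hcon
          have := Finset.sum_eq_zero hcon
          omega
        have hij := (Finset.mem_erase.1 hj).1
        have hj1 : a j = 1 := by have := hle j; omega
        have haj : a = Pi.single i 1 + Pi.single j 1 := by
          ext l
          rcases eq_or_ne l i with rfl | hli
          · simp [hi, hij.symm]
          rcases eq_or_ne l j with rfl | hlj
          · simp [hj1, hij]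
          have h3 : a j + a l ≤ s := by
            rw [hs, ← Finset.add_sum_erase _ _ hj]
            gcongr
            exact Finset.single_le_sum (f := a) (fun _ _ => Nat.zero_le _)
              (Finset.mem_erase.2 ⟨hlj, Finset.mem_erase.2 ⟨hli, Finset.mem_univ l⟩⟩)
          have : a l = 0 := by omega
          simp [this, hli, hlj]
        have h4 : q ≤ B := by
          refine le_trans (le_of_eq ?_) (Finset.single_le_sum
            (f := fun j => if a = Pi.single i 1 + Pi.single j 1 then q else 0)
            (fun j _ => by split_ifs <;> simp [hq0]) hj)
          exact (if_pos haj).symm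
        rw [abs_coprimeCoeff, hsplit, h, hi]
        norm_num
        linarith
    · have h5 : |coprimeCoeff a| * q ^ s ≤ (k + 1) * q ^ 2 :=
        mul_le_mul (abs_coprimeCoeff_le ha) (pow_le_pow_of_le_one hq0 hq1 h) (by positivity)
          (by positivity)
      linarith
  refine (Finset.sum_le_sum hterm).trans ?_
  rw [Finset.sum_add_distrib, Finset.sum_add_distrib, Finset.sum_const, nsmul_eq_mul,
    card_piFinset_range_two, ← mul_assoc]
  refine add_le_add_left (add_le_add ?_ ?_) _
  · rw [Finset.sum_ite_eq']
    split_ifs <;> norm_num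
  · rw [Finset.sum_comm]
    calc ∑ j ∈ Finset.univ.erase i, ∑ a ∈ Fintype.piFinset (fun _ : Fin k => Finset.range 2),
          (if a = Pi.single i 1 + Pi.single j 1 then q else 0)
        ≤ ∑ _j ∈ Finset.univ.erase i, q := Finset.sum_le_sum fun j _ => by
          rw [Finset.sum_ite_eq']
          split_ifs <;> simp [hq0]
      _ = (k - 1 : ℕ) * q := by simp [Finset.card_erase_of_mem]

/-- The linear terms vanish, which makes the local probability at `e = 0` summably close to `1`. -/
theorem one_sub_le_sum_coprimeCoeff (k : ℕ) {q : ℝ} (hq0 : 0 ≤ q) (hq1 : q ≤ 1) :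
    1 - 2 ^ k * (k + 1) * q ^ 2 ≤
      ∑ a ∈ Fintype.piFinset (fun _ : Fin k => Finset.range 2),
        coprimeCoeff a * q ^ (∑ j, a j) := by
  have hterm : ∀ a ∈ Fintype.piFinset (fun _ : Fin k => Finset.range 2),
      (if a = 0 then 1 else 0) - (k + 1) * q ^ 2 ≤ coprimeCoeff a * q ^ (∑ j, a j) := by
    intro a ha
    have hC : 0 ≤ ((k : ℝ) + 1) * q ^ 2 := by positivity
    have hsum : (∑ j, (a j : ℝ)) = ((∑ j, a j : ℕ) : ℝ) := by push_cast; rfl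
    rcases (by omega : ∑ j, a j = 0 ∨ ∑ j, a j = 1 ∨ 2 ≤ ∑ j, a j) with h | h | h
    · have ha0 : a = 0 := by
        ext j
        exact Finset.sum_eq_zero_iff.1 h j (Finset.mem_univ j)
      rw [coprimeCoeff, hsum, h, if_pos ha0]
      norm_num
      linarith
    · have ha0 : a ≠ 0 := by
        rintro rfl
        simp at h
      rw [coprimeCoeff, hsum, h, if_neg ha0]
      norm_num
      linarith
    · have ha0 : a ≠ 0 := by
        rintro rfl
        simp at h
      have h5 : |coprimeCoeff a * q ^ (∑ j, a j)| ≤ (k + 1) * q ^ 2 := by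
        rw [abs_mul, abs_of_nonneg (pow_nonneg hq0 _)]
        exact mul_le_mul (abs_coprimeCoeff_le ha) (pow_le_pow_of_le_one hq0 hq1 h) (by positivity)
          (by positivity)
      rw [if_neg ha0]
      linarith [(abs_le.1 h5).1]
  refine le_trans (le_of_eq ?_) (Finset.sum_le_sum hterm)
  rw [Finset.sum_sub_distrib, Finset.sum_const, nsmul_eq_mul, card_piFinset_range_two,
    Finset.sum_ite_eq', if_pos (by simp), mul_assoc]

/-! ### The local probabilities -/

instance (p : Nat.Primes) : IsProbabilityMeasure (geomLaw p) := by
  unfold geomLaw; infer_instance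

theorem successProb_ne_zero (p : Nat.Primes) : successProb p ≠ 0 := by
  intro h
  have h1 : (1 : ℝ) - 1 / (p : ℝ) = 0 := congrArg Subtype.val h
  have h2 : (1 : ℝ) < p := by exact_mod_cast p.2.one_lt
  have h3 : 1 / (p : ℝ) < 1 := by rw [div_lt_one (by linarith)]; exact h2
  linarith

theorem geomLaw_real_singleton (p : Nat.Primes) (m : ℕ) :
    (geomLaw p).real {m} = (1 - 1 / (p : ℝ)) * (1 / (p : ℝ)) ^ m := by
  rw [geomLaw, geometricMeasure_real_singleton (successProb_ne_zero p)]
  simp only [successProb]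
  rw [sub_sub_cancel, mul_comm]

theorem geomLaw_real_ge (p : Nat.Primes) (m : ℕ) :
    (geomLaw p).real {j | m ≤ j} = (1 / (p : ℝ)) ^ m := by
  induction m with
  | zero => simp
  | succ m ih =>
    have h : {j : ℕ | m ≤ j} = {m} ∪ {j | m + 1 ≤ j} := by
      ext j; simp; omega
    rw [h, measureReal_union (by simp) (MeasurableSet.of_discrete), geomLaw_real_singleton] at ih
    rw [pow_succ]
    linarith

theorem geomLaw_pi_real_ge {k : ℕ} (p : Nat.Primes) (a : Fin k → ℕ) :
    (Measure.pi fun _ : Fin k => geomLaw p).real {v | ∀ i, a i ≤ v i} =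
      (1 / (p : ℝ)) ^ (∑ i, a i) := by
  have h : {v : Fin k → ℕ | ∀ i, a i ≤ v i} = Set.univ.pi fun i => {j | a i ≤ j} := by
    ext v; simp
  rw [h, measureReal_def, Measure.pi_pi, ENNReal.toReal_prod, ← Finset.prod_pow_eq_pow_sum]
  exact Finset.prod_congr rfl fun i _ => geomLaw_real_ge p (a i)

/-- The probability that `∑ 𝒢ⱼ(p) - max 𝒢ⱼ(p) = e`. -/
noncomputable def localProb (k : ℕ) (p : Nat.Primes) (e : ℕ) : ℝ :=
  (Measure.pi fun _ : Fin k => geomLaw p).real {v | ∑ j, v j = e + Finset.univ.sup v}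

theorem localProb_nonneg (k : ℕ) (p : Nat.Primes) (e : ℕ) : 0 ≤ localProb k p e :=
  measureReal_nonneg

theorem localProb_le_one (k : ℕ) (p : Nat.Primes) (e : ℕ) : localProb k p e ≤ 1 :=
  measureReal_le_one

/-- Integrating the expansion uses the same coefficients as the lattice count, with `p ^ (-∑ a)`
playing the role of the density of the divisibility conditions. -/
theorem localProb_eq_sum {k e : ℕ} {A : Finset (Fin k → ℕ)} {h : (Fin k → ℕ) → ℝ}
    (hA : IsLocalExpansion k e A h) (p : Nat.Primes) :
    localProb k p e = ∑ a ∈ A, h a * (1 / (p : ℝ)) ^ (∑ i, a i) := by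
  set μ := Measure.pi fun _ : Fin k => geomLaw p
  have h1 : ∀ s : Set (Fin k → ℕ), μ.real s = ∫ v, s.indicator 1 v ∂μ := fun s =>
    (integral_indicator_one (MeasurableSet.of_discrete)).symm
  have h2 : ({v : Fin k → ℕ | ∑ j, v j = e + Finset.univ.sup v}).indicator (1 : (Fin k → ℕ) → ℝ) =
      fun v => ∑ a ∈ A, h a * ({v : Fin k → ℕ | ∀ i, a i ≤ v i}).indicator 1 v := by
    ext v
    simpa [Set.indicator_apply] using hA v
  rw [localProb, h1, h2, integral_finsetSum]
  · refine Finset.sum_congr rfl fun a _ => ?_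
    rw [integral_const_mul, ← h1, geomLaw_pi_real_ge]
  · intro a _
    refine Integrable.const_mul ?_ _
    exact (integrable_const (1 : ℝ)).indicator (MeasurableSet.of_discrete)

theorem lastMaxPos_le_iff {d : ℕ} (y : Fin d → ℕ) (a : ℕ) :
    lastMaxPos y ≤ a ↔ ∀ i : Fin d, a ≤ i → y i < Finset.univ.sup y := by
  simp only [lastMaxPos, Finset.sup_le_iff, Finset.mem_filter, Finset.mem_univ, true_and]
  constructor
  · intro h i hi
    refine lt_of_le_of_ne (Finset.le_sup (Finset.mem_univ i)) fun h' => ?_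
    have := h i h'
    omega
  · intro h i hi
    by_contra hcon
    exact (h i (by omega)).ne hi

theorem lastMaxPos_le {d : ℕ} (y : Fin d → ℕ) : lastMaxPos y ≤ d :=
  (lastMaxPos_le_iff y d).2 fun i hi => absurd i.2 (by omega)

/-- The least value at position `a` that makes `a` the last position of the maximum, the other
values being `y`. -/
noncomputable def lastMaxThreshold {d : ℕ} (a : Fin (d + 1)) (y : Fin d → ℕ) : ℕ :=
  Finset.univ.sup y + if lastMaxPos y ≤ a then 0 else 1

theorem lastMaxThreshold_le_iff {d : ℕ} (a : Fin (d + 1)) (y : Fin d → ℕ) (m : ℕ) :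
    lastMaxThreshold a y ≤ m ↔ (∀ i, y i ≤ m) ∧ ∀ i : Fin d, (a : ℕ) ≤ i → y i < m := by
  have hsup : (∀ i, y i ≤ m) ↔ Finset.univ.sup y ≤ m := by simp
  rw [hsup, lastMaxThreshold]
  split_ifs with h
  · rw [lastMaxPos_le_iff] at h
    exact ⟨fun h1 => ⟨h1, fun i hi => (h i hi).trans_le h1⟩, fun h1 => h1.1⟩
  · rw [lastMaxPos_le_iff] at h
    push Not at h
    obtain ⟨i, hi, hi'⟩ := h
    constructor
    · intro h1
      refine ⟨by omega, fun j _ => ?_⟩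
      have : y j ≤ Finset.univ.sup y := Finset.le_sup (Finset.mem_univ j)
      omega
    · rintro ⟨-, h2⟩
      have := h2 i hi
      omega

/-- Among the `d + 1` insertion positions, the `lastMaxPos y` first ones precede a maximal entry of
`y` and must exceed it strictly; at the others equality suffices. -/
theorem sum_pow_lastMaxThreshold {d : ℕ} (q : ℝ) (y : Fin d → ℕ) :
    ∑ a : Fin (d + 1), (1 / q) ^ lastMaxThreshold a y =
      (((d + 1 : ℕ) : ℝ) - (lastMaxPos y : ℝ)) / q ^ (Finset.univ.sup y) +
        (lastMaxPos y : ℝ) / q ^ (Finset.univ.sup y + 1) := by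
  have hth : ∀ a : Fin (d + 1), (1 / q) ^ lastMaxThreshold a y =
      if lastMaxPos y ≤ (a : ℕ) then 1 / q ^ (Finset.univ.sup y)
        else 1 / q ^ (Finset.univ.sup y + 1) := fun a => by
    rw [lastMaxThreshold]
    split_ifs <;> simp
  simp only [hth]
  rw [Fin.sum_univ_eq_sum_range (fun a => if lastMaxPos y ≤ a then
    1 / q ^ (Finset.univ.sup y) else 1 / q ^ (Finset.univ.sup y + 1)) (d + 1),
    Finset.sum_ite, Finset.sum_const, Finset.sum_const]
  have hle := lastMaxPos_le y
  have c1 : ((Finset.range (d + 1)).filter fun a => lastMaxPos y ≤ a).card =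
      d + 1 - lastMaxPos y := by
    have : (Finset.range (d + 1)).filter (fun a => lastMaxPos y ≤ a) =
        Finset.Ico (lastMaxPos y) (d + 1) := by
      ext a; simp; omega
    rw [this, Nat.card_Ico]
  have c2 : ((Finset.range (d + 1)).filter fun a => ¬ lastMaxPos y ≤ a).card =
      lastMaxPos y := by
    have : (Finset.range (d + 1)).filter (fun a => ¬ lastMaxPos y ≤ a) =
        Finset.range (lastMaxPos y) := by
      ext a; simp; omega
    rw [this, Finset.card_range]
  rw [c1, c2, nsmul_eq_mul, nsmul_eq_mul, Nat.cast_sub (by omega)]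
  ring

theorem geomLaw_pi_real_insertNth {d : ℕ} (p : Nat.Primes) (a : Fin (d + 1)) (y : Fin d → ℕ)
    (m : ℕ) :
    (Measure.pi fun _ : Fin (d + 1) => geomLaw p).real {g | a.removeNth g = y ∧ m ≤ g a} =
      (1 - 1 / (p : ℝ)) ^ d * (1 / (p : ℝ)) ^ (∑ i, y i) * (1 / (p : ℝ)) ^ m := by
  have h : {g : Fin (d + 1) → ℕ | a.removeNth g = y ∧ m ≤ g a} =
      Set.univ.pi (a.insertNth (α := fun _ => Set ℕ) {j | m ≤ j} fun i => {y i}) := by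
    ext g
    simp only [Set.mem_ofPred_eq, Set.mem_univ_pi, Fin.forall_iff_succAbove a,
      Fin.insertNth_apply_same, Fin.insertNth_apply_succAbove, Set.mem_singleton_iff,
      funext_iff, Fin.removeNth]
    tauto
  rw [h, measureReal_def, Measure.pi_pi, ENNReal.toReal_prod, Fin.prod_univ_succAbove _ a]
  simp only [Fin.insertNth_apply_same, Fin.insertNth_apply_succAbove, ← measureReal_def,
    geomLaw_real_singleton, geomLaw_real_ge, Finset.prod_mul_distrib, Finset.prod_const,
    Finset.card_univ, Fintype.card_fin, Finset.prod_pow_eq_pow_sum]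
  ring

theorem exists_last_max_index {d : ℕ} (g : Fin (d + 1) → ℕ) :
    ∃ a, (∀ j, g j ≤ g a) ∧ ∀ j, a < j → g j < g a := by
  obtain ⟨m, hm⟩ := exists_max_index g
  obtain ⟨a, ha, hmax⟩ := Finset.exists_max_image (Finset.univ.filter fun j => g j = g m) id
    ⟨m, by simp⟩
  have ha' : g a = g m := (Finset.mem_filter.1 ha).2
  refine ⟨a, fun j => ha' ▸ hm j, fun j hj => lt_of_le_of_ne (ha' ▸ hm j) fun h => ?_⟩
  exact absurd (hmax j (by simp [h, ha'])) (not_le.2 hj)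

theorem lastMaxThreshold_removeNth_le_iff {d : ℕ} (a : Fin (d + 1)) (g : Fin (d + 1) → ℕ) :
    lastMaxThreshold a (a.removeNth g) ≤ g a ↔
      (∀ j, g j ≤ g a) ∧ ∀ j, a < j → g j < g a := by
  rw [lastMaxThreshold_le_iff, Fin.forall_iff_succAbove a (P := fun j => g j ≤ g a),
    Fin.forall_iff_succAbove a (P := fun j => a < j → g j < g a)]
  simp only [Fin.removeNth, le_refl, true_and, lt_irrefl, false_imp_iff]
  -- Entry `i` of the shortened tuple comes from position `a.succAbove i`, which lies after `a`
  -- exactly when `a ≤ i`.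
  refine and_congr_right fun _ => forall_congr' fun i => imp_congr_left ?_
  rw [Fin.lt_succAbove_iff_le_castSucc, Fin.le_def]
  rfl

theorem eulerFactor_succ (d p e : ℕ) :
    eulerFactor (d + 1) p e = ∑ y ∈ Finset.finAntidiagonal d e,
      (1 - 1 / (p : ℝ)) ^ d * (1 / (p : ℝ) ^ e) *
        ((((d + 1 : ℕ) : ℝ) - (lastMaxPos y : ℝ)) / (p : ℝ) ^ (Finset.univ.sup y) +
          (lastMaxPos y : ℝ) / (p : ℝ) ^ (Finset.univ.sup y + 1)) := rfl

/-- The event is partitioned by the last index `a` of the maximum and by the remaining tuple `y`,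
which has sum `e`. Then `g a` is only constrained from below, by `lastMaxThreshold a y`. -/
theorem localProb_eq_eulerFactor {k : ℕ} (hk : 1 ≤ k) (p : Nat.Primes) (e : ℕ) :
    localProb k p e = eulerFactor k p e := by
  obtain ⟨d, rfl⟩ : ∃ d, k = d + 1 := ⟨k - 1, by omega⟩
  have hset : {g : Fin (d + 1) → ℕ | ∑ j, g j = e + Finset.univ.sup g} =
      ⋃ z ∈ (Finset.finAntidiagonal d e ×ˢ (Finset.univ : Finset (Fin (d + 1)))),
        {g | z.2.removeNth g = z.1 ∧ lastMaxThreshold z.2 z.1 ≤ g z.2} := by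
    ext g
    simp only [Set.mem_ofPred_eq, Set.mem_iUnion, Finset.mem_product, Finset.mem_univ, and_true,
      Finset.mem_finAntidiagonal, exists_prop, Prod.exists]
    have hsum : ∀ a : Fin (d + 1), ∑ j, g j = g a + ∑ i, a.removeNth g i := fun a =>
      Fin.sum_univ_succAbove g a
    constructor
    · intro h
      obtain ⟨a, ha⟩ := exists_last_max_index g
      refine ⟨a.removeNth g, a, ?_, rfl, (lastMaxThreshold_removeNth_le_iff a g).2 ha⟩
      have := hsum a
      rw [sup_eq_of_forall_le ha.1] at h
      omega
    · rintro ⟨y, a, hy, rfl, h⟩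
      rw [lastMaxThreshold_removeNth_le_iff] at h
      rw [sup_eq_of_forall_le h.1, hsum a, hy, add_comm]
  rw [localProb, hset, measureReal_biUnion_finset]
  · rw [Finset.sum_product, eulerFactor_succ]
    refine Finset.sum_congr rfl fun y hy => ?_
    rw [Finset.mem_finAntidiagonal] at hy
    simp only [geomLaw_pi_real_insertNth, ← Finset.mul_sum]
    rw [sum_pow_lastMaxThreshold, hy, one_div_pow]
  · rintro ⟨y, a⟩ _ ⟨z, b⟩ _ hne
    rw [Function.onFun, Set.disjoint_left]
    rintro g ⟨h1, h2⟩ ⟨h3, h4⟩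
    dsimp only at h1 h2 h3 h4
    subst h1 h3
    rw [lastMaxThreshold_removeNth_le_iff] at h2 h4
    refine hne ?_
    rcases lt_trichotomy a b with h | rfl | h
    · exact absurd (h4.1 a) (not_le.2 (h2.2 b h))
    · rfl
    · exact absurd (h2.1 b) (not_le.2 (h4.2 a h))
  · intro _ _
    exact MeasurableSet.of_discrete

/-! ### The Euler product of `pk` -/

theorem prime_pow_inv_pos (p : Nat.Primes) (m : ℕ) : (0 : ℝ) < ((p : ℝ) ^ m)⁻¹ := by
  have : (0 : ℝ) < p := by exact_mod_cast p.2.pos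
  positivity

theorem prime_pow_inv_le_one (p : Nat.Primes) (m : ℕ) : ((p : ℝ) ^ m)⁻¹ ≤ 1 :=
  inv_le_one_of_one_le₀ (one_le_pow₀ (by exact_mod_cast p.2.one_lt.le))

theorem prime_pow_inv_le_half (p : Nat.Primes) {m : ℕ} (hm : m ≠ 0) :
    ((p : ℝ) ^ m)⁻¹ ≤ 1 / 2 := by
  have h2 : (2 : ℝ) ≤ p := by exact_mod_cast p.2.two_le
  rw [one_div]
  refine inv_anti₀ (by norm_num) (h2.trans ?_)
  exact le_self_pow₀ (by linarith) hm

theorem tprod_prime_pow_inv_le (D : Nat.Primes → ℕ) (s : Finset Nat.Primes) :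
    ∏' p : Nat.Primes, ((p : ℝ) ^ D p)⁻¹ ≤ ∏ p ∈ s, ((p : ℝ) ^ D p)⁻¹ := by
  have hbdd : BddBelow (Set.range fun s : Finset Nat.Primes => ∏ p ∈ s, ((p : ℝ) ^ D p)⁻¹) :=
    ⟨0, by rintro _ ⟨s, rfl⟩; exact Finset.prod_nonneg fun p _ => (prime_pow_inv_pos p _).le⟩
  have hanti : Antitone fun s : Finset Nat.Primes => ∏ p ∈ s, ((p : ℝ) ^ D p)⁻¹ :=
    fun s t hst => Finset.prod_le_prod_of_subset_of_le_one hst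
      (fun p _ => (prime_pow_inv_pos p _).le) fun p _ _ => prime_pow_inv_le_one p _
  have h : HasProd (fun p : Nat.Primes => ((p : ℝ) ^ D p)⁻¹) _ := tendsto_atTop_ciInf hanti hbdd
  rw [h.tprod_eq]
  exact ciInf_le hbdd s

/-- Infinitely many nonzero exponents would bound the product by every `(1 / 2) ^ N`, hence make it
smaller than `1 / n`. Otherwise it is the inverse of an integer and unique factorization applies. -/
theorem tprod_prime_pow_inv_eq_iff (D : Nat.Primes → ℕ) {n : ℕ} (hn : 1 ≤ n) :
    ∏' p : Nat.Primes, ((p : ℝ) ^ D p)⁻¹ = 1 / (n : ℝ) ↔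
      ∀ p : Nat.Primes, D p = n.factorization p := by
  have hn0 : n ≠ 0 := by omega
  have hn' : (0 : ℝ) < n := by exact_mod_cast hn
  have hfin : ∀ D : Nat.Primes → ℕ, ∀ hD : {p | D p ≠ 0}.Finite,
      ∏' p : Nat.Primes, ((p : ℝ) ^ D p)⁻¹ =
        1 / ((∏ p ∈ hD.toFinset, (p : ℕ) ^ D p : ℕ) : ℝ) := by
    intro D hD
    rw [tprod_eq_prod (s := hD.toFinset) fun p hp => by
      have : D p = 0 := by simpa using hp
      simp [this]]
    push_cast
    rw [Finset.prod_inv_distrib, one_div]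
  have hfact : ∀ (D : Nat.Primes → ℕ) (s : Finset Nat.Primes) (q : Nat.Primes),
      (∏ p ∈ s, (p : ℕ) ^ D p).factorization q = if q ∈ s then D q else 0 := by
    intro D s q
    rw [Nat.factorization_prod_apply fun p _ => pow_ne_zero _ p.2.ne_zero]
    rw [Finset.sum_congr rfl (g := fun p => if p = q then D p else 0)]
    · simp
    · intro p _
      rw [p.2.factorization_pow, Finsupp.single_apply]
      simp [Nat.Primes.coe_nat_inj]
  have hpos : ∀ (D : Nat.Primes → ℕ) (s : Finset Nat.Primes), ∏ p ∈ s, (p : ℕ) ^ D p ≠ 0 :=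
    fun D s => Finset.prod_ne_zero_iff.2 fun p _ => pow_ne_zero _ p.2.ne_zero
  constructor
  · intro h
    have hD : {p | D p ≠ 0}.Finite := by
      by_contra hinf
      obtain ⟨N, hN⟩ := exists_pow_lt_of_lt_one (one_div_pos.2 hn') (by norm_num : (1 : ℝ) / 2 < 1)
      obtain ⟨s, hs, hcard⟩ := Set.Infinite.exists_subset_card_eq hinf N
      have h1 := tprod_prime_pow_inv_le D s
      have h2 : ∏ p ∈ s, ((p : ℝ) ^ D p)⁻¹ ≤ (1 / 2) ^ N := by
        rw [← hcard, ← Finset.prod_const]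
        exact Finset.prod_le_prod (fun p _ => (prime_pow_inv_pos p _).le)
          fun p hp => prime_pow_inv_le_half p (hs hp)
      rw [h] at h1
      linarith
    rw [hfin D hD] at h
    have h1 : ∏ p ∈ hD.toFinset, (p : ℕ) ^ D p = n := by
      rw [one_div, one_div, inv_inj] at h
      exact_mod_cast h
    intro q
    rw [← h1, hfact]
    split_ifs with hq
    · rfl
    · simpa using hq
  · intro h
    have hD : {p | D p ≠ 0}.Finite := by
      refine Set.Finite.of_injOn (f := fun p : Nat.Primes => (p : ℕ)) (t := n.primeFactors) ?_
        (fun p _ q _ hpq => Nat.Primes.coe_nat_injective hpq) (Finset.finite_toSet _)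
      intro p hp
      rw [Set.mem_ofPred_eq, h p] at hp
      exact Nat.support_factorization n ▸ Finsupp.mem_support_iff.2 hp
    rw [hfin D hD]
    congr 2
    refine Nat.eq_of_factorization_eq (hpos _ _) hn0 fun q => ?_
    by_cases hq : q.Prime
    · rw [hfact D _ ⟨q, hq⟩, ← h ⟨q, hq⟩]
      split_ifs with h1
      · rfl
      · exact by_contra fun h2 => h1 (hD.mem_toFinset.2 fun h3 => h2 h3.symm)
    · rw [Nat.factorization_eq_zero_of_not_prime _ hq, Nat.factorization_eq_zero_of_not_prime _ hq]

theorem sup_le_sum {k : ℕ} (v : Fin k → ℕ) : Finset.univ.sup v ≤ ∑ j, v j :=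
  Finset.sup_le fun j _ => Finset.single_le_sum (fun _ _ => Nat.zero_le _) (Finset.mem_univ j)

theorem R_eq_one_div_iff {k : ℕ} (g : Nat.Primes → Fin k → ℕ) {n : ℕ} (hn : 1 ≤ n) :
    R k g = 1 / (n : ℝ) ↔
      ∀ p : Nat.Primes, ∑ j, g p j = n.factorization p + Finset.univ.sup (g p) := by
  have hR : R k g = ∏' p : Nat.Primes,
      ((p : ℝ) ^ (∑ j, g p j - Finset.univ.sup (g p)))⁻¹ := by
    refine tprod_congr fun p => ?_
    have hp : (p : ℝ) ≠ 0 := by exact_mod_cast p.2.ne_zero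
    rw [← zpow_natCast, ← zpow_neg, Nat.cast_sub (sup_le_sum (g p)), neg_sub]
  rw [hR, tprod_prime_pow_inv_eq_iff _ hn]
  refine forall_congr' fun p => ?_
  have := sup_le_sum (g p)
  omega

/-- The event is the decreasing intersection of cylinders over finite sets of primes. Continuity
from above along all finite sets gives unconditional convergence. -/
theorem hasProd_localProb (k : ℕ) {n : ℕ} (hn : 1 ≤ n) :
    HasProd (fun p : Nat.Primes => localProb k p (n.factorization p)) (pk k n) := by
  set E : Nat.Primes → Set (Fin k → ℕ) :=
    fun p => {v | ∑ j, v j = n.factorization p + Finset.univ.sup v} with hE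
  set S : Finset Nat.Primes → Set (Nat.Primes → Fin k → ℕ) := fun s => (s : Set Nat.Primes).pi E
  have hprob : IsProbabilityMeasure (jointLaw k) := by unfold jointLaw; infer_instance
  have hmeas : ∀ s, MeasurableSet (S s) := fun s =>
    MeasurableSet.pi s.countable_toSet fun _ _ => MeasurableSet.of_discrete
  have hset : {g | R k g = 1 / (n : ℝ)} = ⋂ s, S s := by
    ext g
    simp only [Set.mem_ofPred_eq, R_eq_one_div_iff g hn, Set.mem_iInter]
    exact ⟨fun h s p _ => h p, fun h p => h {p} p (by simp)⟩
  have hlim := tendsto_measure_iInter_atTop (μ := jointLaw k) (s := S)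
    (fun s => (hmeas s).nullMeasurableSet)
    (fun s t hst g hg p hp => hg p (hst hp)) ⟨∅, measure_ne_top _ _⟩
  have hlim' := (ENNReal.tendsto_toReal (measure_ne_top _ _)).comp hlim
  rw [← hset] at hlim'
  refine hlim'.congr fun s => ?_
  simp only [Function.comp, S, jointLaw]
  rw [Measure.infinitePi_pi _ fun _ _ => MeasurableSet.of_discrete, ENNReal.toReal_prod]
  rfl

theorem pk_le_prod (k : ℕ) {n : ℕ} (hn : 1 ≤ n) (s : Finset Nat.Primes) :
    pk k n ≤ ∏ p ∈ s, localProb k p (n.factorization p) := by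
  refine Antitone.le_of_tendsto (fun s t hst => ?_) (hasProd_localProb k hn) s
  exact Finset.prod_le_prod_of_subset_of_le_one hst
    (fun p _ => localProb_nonneg _ _ _) fun p _ _ => localProb_le_one _ _ _

/-! ### Counting tuples subject to finitely many local conditions -/

/-- The number of `X ∈ {1, …, x}^k` with `∏ X i > c * x ^ k` that satisfy
`∑ v_p(X i) = e p + max v_p(X i)` for the primes `p` in `s`. -/
noncomputable def localCount (k x : ℕ) (s : Finset Nat.Primes) (e : Nat.Primes → ℕ) (c : ℝ) : ℝ :=
  ∑ X ∈ Fintype.piFinset (fun _ : Fin k => Finset.Icc 1 x),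
    if (∀ p ∈ s, ∑ j, (X j).factorization p =
        e p + Finset.univ.sup fun j => (X j).factorization p) ∧
      c * (x : ℝ) ^ k < ∏ i, (X i : ℝ) then 1 else 0

/-- The moduli attached to a choice of exponents at the primes in `s`. -/
def primePowProd {k : ℕ} (s : Finset Nat.Primes) (σ : s → Fin k → ℕ) (i : Fin k) : ℕ :=
  ∏ p : s, (p.1 : ℕ) ^ σ p i

theorem primePowProd_pos {k : ℕ} (s : Finset Nat.Primes) (σ : s → Fin k → ℕ) (i : Fin k) :
    0 < primePowProd s σ i :=
  Finset.prod_pos fun p _ => pow_pos p.1.2.pos _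

theorem primePowProd_dvd_iff {k : ℕ} (s : Finset Nat.Primes) (σ : s → Fin k → ℕ) (i : Fin k)
    {m : ℕ} (hm : m ≠ 0) :
    primePowProd s σ i ∣ m ↔ ∀ p : s, σ p i ≤ m.factorization p.1 := by
  have hp : ∀ p : s, (p.1 : ℕ) ^ σ p i ∣ m ↔ σ p i ≤ m.factorization p.1 := fun p =>
    p.1.2.pow_dvd_iff_le_factorization hm
  simp only [← hp]
  refine ⟨fun h p => (Finset.dvd_prod_of_mem _ (Finset.mem_univ p)).trans h, fun h => ?_⟩
  refine Finset.prod_dvd_of_isRelPrime (fun p _ q _ hpq => ?_) fun p _ => h p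
  refine Nat.coprime_iff_isRelPrime.1 (Nat.Coprime.pow _ _ ?_)
  exact (Nat.coprime_primes p.1.2 q.1.2).2 fun h' =>
    hpq (Subtype.ext (Nat.Primes.coe_nat_injective h'))

theorem prod_inv_primePowProd {k : ℕ} (s : Finset Nat.Primes) (σ : s → Fin k → ℕ)
    (t : Finset (Fin k)) :
    ∏ i ∈ t, ((primePowProd s σ i : ℝ))⁻¹ = ∏ p : s, (1 / (p.1 : ℝ)) ^ (∑ i ∈ t, σ p i) := by
  simp only [primePowProd, Nat.cast_prod, Nat.cast_pow, ← Finset.prod_inv_distrib]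
  rw [Finset.prod_comm]
  refine Finset.prod_congr rfl fun p _ => ?_
  rw [← Finset.prod_pow_eq_pow_sum]
  exact Finset.prod_congr rfl fun i _ => by rw [one_div, inv_pow]

section expansion

variable {k : ℕ} {e : Nat.Primes → ℕ} {A : Nat.Primes → Finset (Fin k → ℕ)}
  {h : Nat.Primes → (Fin k → ℕ) → ℝ}

/-- Multiplying the local expansions out selects one exponent vector `σ p` per prime, and the
orthant conditions merge into divisibility by the moduli `primePowProd s σ i`. -/
theorem localCount_eq_sum (hA : ∀ p, IsLocalExpansion k (e p) (A p) (h p)) (x : ℕ)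
    (s : Finset Nat.Primes) (c : ℝ) :
    localCount k x s e c = ∑ σ ∈ Fintype.piFinset (fun p : s => A p.1),
      (∏ p : s, h p.1 (σ p)) * hypCount k x (primePowProd s σ) c := by
  classical
  simp only [localCount, hypCount, Finset.mul_sum]
  rw [Finset.sum_comm]
  refine Finset.sum_congr rfl fun X hX => ?_
  have hX0 : ∀ i, X i ≠ 0 := fun i => by
    have := (Finset.mem_Icc.1 (Fintype.mem_piFinset.1 hX i)).1
    omega
  by_cases hc : c * (x : ℝ) ^ k < ∏ i, (X i : ℝ)
  · simp only [hc, and_true]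
    have h1 : (if ∀ p ∈ s, ∑ j, (X j).factorization p =
        e p + Finset.univ.sup fun j => (X j).factorization p then (1 : ℝ) else 0) =
        ∏ p : s, ∑ a ∈ A p.1, h p.1 a * if ∀ i, a i ≤ (X i).factorization p.1 then 1 else 0 := by
      simp only [← hA _ _]
      rw [Finset.prod_ite_zero]
      simp
    rw [h1, Finset.prod_univ_sum]
    refine Finset.sum_congr rfl fun σ _ => ?_
    rw [Finset.prod_mul_distrib, Finset.prod_ite_zero]
    simp only [primePowProd_dvd_iff s σ _ (hX0 _), Finset.mem_univ, true_imp_iff,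
      Finset.prod_const_one]
    congr 2
    exact propext forall_comm
  · simp [hc]

/-- Relative to the density `∏ 1 / d i`, the lattice error `∑ d i / x` becomes `x⁻¹ * ∑ i, ∏ j ≠ i,
1 / d j`. This and the main term are multiplicative in `σ`, so both sums over `σ` factor over the
primes. -/
theorem abs_localCount_sub_le (hA : ∀ p, IsLocalExpansion k (e p) (A p) (h p)) {x : ℕ}
    (hx : 0 < x) (s : Finset Nat.Primes) {c : ℝ} (hc : 0 < c) :
    |localCount k x s e c / (x : ℝ) ^ k - hypVol k c * ∏ p ∈ s, localProb k p (e p)| ≤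
      (x : ℝ)⁻¹ * ∑ i : Fin k, ∏ p ∈ s,
        ∑ a ∈ A p, |h p a| * (1 / (p : ℝ)) ^ (∑ j ∈ Finset.univ.erase i, a j) := by
  classical
  have hx' : (0 : ℝ) < x := by exact_mod_cast hx
  set P := Fintype.piFinset (fun p : s => A p.1) with hP
  have hmain : ∏ p ∈ s, localProb k p (e p) = ∑ σ ∈ P,
      (∏ p : s, h p.1 (σ p)) * ∏ i, ((primePowProd s σ i : ℝ))⁻¹ := by
    rw [← Finset.prod_coe_sort]
    simp only [localProb_eq_sum (hA _)]
    rw [Finset.prod_univ_sum]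
    refine Finset.sum_congr rfl fun σ _ => ?_
    rw [Finset.prod_mul_distrib, prod_inv_primePowProd]
  have herr : ∀ i : Fin k, ∏ p ∈ s, ∑ a ∈ A p, |h p a| *
      (1 / (p : ℝ)) ^ (∑ j ∈ Finset.univ.erase i, a j) = ∑ σ ∈ P,
        |∏ p : s, h p.1 (σ p)| * ∏ j ∈ Finset.univ.erase i, ((primePowProd s σ j : ℝ))⁻¹ := by
    intro i
    rw [← Finset.prod_coe_sort, Finset.prod_univ_sum]
    refine Finset.sum_congr rfl fun σ _ => ?_
    rw [Finset.prod_mul_distrib, prod_inv_primePowProd, Finset.abs_prod]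
  simp only [herr]
  rw [hmain, localCount_eq_sum hA, Finset.sum_div, Finset.mul_sum, ← Finset.sum_sub_distrib,
    Finset.sum_comm, Finset.mul_sum]
  refine (Finset.abs_sum_le_sum_abs _ _).trans (Finset.sum_le_sum fun σ _ => ?_)
  set d := primePowProd s σ with hd
  have hd0 : ∀ i, (0 : ℝ) < d i := fun i => by exact_mod_cast primePowProd_pos s σ i
  set Q : ℝ := ∏ i, ((d i : ℝ))⁻¹ with hQ
  have hQ0 : 0 < Q := Finset.prod_pos fun i _ => inv_pos.2 (hd0 i)
  have hdx : (∏ i, (d i / x : ℝ)) = Q⁻¹ / (x : ℝ) ^ k := by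
    rw [Finset.prod_div_distrib, hQ, Finset.prod_inv_distrib, inv_inv]
    simp
  have hdisc := abs_hypCount_sub_hypVol_le k hc hx d (primePowProd_pos s σ)
  rw [hdx] at hdisc
  have hrew : (∏ p : s, h p.1 (σ p)) * hypCount k x d c / (x : ℝ) ^ k -
      hypVol k c * ((∏ p : s, h p.1 (σ p)) * Q) =
      (∏ p : s, h p.1 (σ p)) * Q * (Q⁻¹ / (x : ℝ) ^ k * hypCount k x d c - hypVol k c) := by
    field_simp
  rw [hrew, abs_mul, abs_mul, abs_of_pos hQ0, ← Finset.mul_sum]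
  have hsum : ∑ i, ∏ j ∈ Finset.univ.erase i, ((d j : ℝ))⁻¹ = ∑ i, (d i : ℝ) * Q := by
    refine Finset.sum_congr rfl fun i _ => ?_
    rw [hQ, ← Finset.mul_prod_erase _ _ (Finset.mem_univ i), mul_inv_cancel_left₀ (hd0 i).ne']
  rw [hsum, ← Finset.sum_mul]
  calc _ ≤ |∏ p : s, h p.1 (σ p)| * Q * ∑ i, (d i / x : ℝ) :=
        mul_le_mul_of_nonneg_left hdisc (by positivity)
    _ = _ := by rw [← Finset.sum_div]; ring

end expansion

/-! ### The uniform law -/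

theorem uniformOn_Icc_real_singleton {x a : ℕ} (ha : a ∈ Finset.Icc 1 x) :
    (uniformOn (Set.Icc 1 x)).real {a} = (x : ℝ)⁻¹ := by
  have h : (uniformOn (Set.Icc 1 x)) {a} = (x : ENNReal)⁻¹ := by
    have := uniformOn_apply_finset (s := Finset.Icc 1 x) (t := {a})
    rw [Finset.coe_Icc, Finset.coe_singleton] at this
    rw [this, Finset.inter_singleton_of_mem ha]
    simp
  rw [measureReal_def, h]
  simp

theorem uniformTuple_real (k : ℕ) {x : ℕ} (hx : 0 < x) (S : Set (Fin k → ℕ)) [DecidablePred (· ∈ S)] :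
    (uniformTuple k x).real S =
      (∑ X ∈ Fintype.piFinset (fun _ : Fin k => Finset.Icc 1 x), if X ∈ S then 1 else 0) /
        (x : ℝ) ^ k := by
  have hprob : IsProbabilityMeasure (uniformOn (Set.Icc 1 x)) :=
    isProbabilityMeasure_uniformOn (Set.finite_Icc 1 x) ⟨1, by simp; omega⟩
  set B := Fintype.piFinset (fun _ : Fin k => Finset.Icc 1 x) with hB
  have hBset : (B : Set (Fin k → ℕ)) = Set.univ.pi fun _ => Set.Icc 1 x := by
    ext X; simp [hB]
  have hprob' : IsProbabilityMeasure (uniformTuple k x) := by unfold uniformTuple; infer_instance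
  have hB1 : uniformTuple k x (B : Set (Fin k → ℕ))ᶜ = 0 := by
    rw [prob_compl_eq_zero_iff (MeasurableSet.of_discrete), hBset, uniformTuple, Measure.pi_pi]
    simp [uniformOn_self (Set.finite_Icc 1 x) ⟨1, by simp; omega⟩]
  have hS : (uniformTuple k x).real S = (uniformTuple k x).real ((B.filter (· ∈ S) : Finset _)) := by
    refine measureReal_congr ?_
    have : ∀ᵐ X ∂uniformTuple k x, X ∈ (B : Set (Fin k → ℕ)) := hB1
    filter_upwards [this] with X hX
    refine propext ⟨fun h => ?_, fun h => ?_⟩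
    · exact Finset.mem_coe.2 (Finset.mem_filter.2 ⟨hX, h⟩)
    · exact (Finset.mem_filter.1 (Finset.mem_coe.1 h)).2
  rw [hS, ← sum_measureReal_singleton, Finset.sum_div, Finset.sum_filter]
  refine Finset.sum_congr rfl fun X hX => ?_
  split_ifs
  · rw [measureReal_def, uniformTuple, ← Set.univ_pi_singleton, Measure.pi_pi, ENNReal.toReal_prod]
    simp only [← measureReal_def]
    rw [Finset.prod_congr rfl fun i _ =>
      uniformOn_Icc_real_singleton (Fintype.mem_piFinset.1 hX i)]
    simp
  · simp

/-! ### Bounds for truncated Euler products -/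

/-- The primes up to `y`. -/
def primesUpTo (y : ℕ) : Finset Nat.Primes :=
  (Finset.range (y + 1)).subtype Nat.Prime

theorem mem_primesUpTo {y : ℕ} {p : Nat.Primes} : p ∈ primesUpTo y ↔ (p : ℕ) ≤ y := by
  have : p ∈ primesUpTo y ↔ (p : ℕ) ∈ Finset.range (y + 1) := Finset.mem_subtype
  rw [this, Finset.mem_range, Nat.lt_succ_iff]

theorem prod_primesUpTo (y : ℕ) (F : ℕ → ℝ) :
    ∏ p ∈ primesUpTo y, F p = ∏ p ∈ Nat.primesLE y, F p := by
  refine Finset.prod_nbij (fun p : Nat.Primes => (p : ℕ)) ?_ ?_ ?_ fun _ _ => rfl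
  · intro p hp
    exact Nat.mem_primesLE.2 ⟨mem_primesUpTo.1 hp, p.2⟩
  · exact fun p _ q _ h => Nat.Primes.coe_nat_injective h
  · intro p hp
    have := Nat.mem_primesLE.1 hp
    exact ⟨⟨p, this.2⟩, mem_primesUpTo.2 this.1, rfl⟩

theorem summable_prime_inv_sq : Summable fun p : Nat.Primes => (1 / (p : ℝ)) ^ 2 := by
  have : Summable fun n : ℕ => (1 / (n : ℝ)) ^ 2 := by
    simp
  exact this.comp_injective Nat.Primes.coe_nat_injective

theorem one_sub_sum_le_prod {ι : Type*} (s : Finset ι) (f : ι → ℝ) (h0 : ∀ i ∈ s, 0 ≤ f i)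
    (h1 : ∀ i ∈ s, f i ≤ 1) : 1 - ∑ i ∈ s, (1 - f i) ≤ ∏ i ∈ s, f i := by
  classical
  induction s using Finset.induction_on with
  | empty => simp
  | insert a s ha ih =>
    have ih' := ih (fun i hi => h0 i (Finset.mem_insert_of_mem hi))
      fun i hi => h1 i (Finset.mem_insert_of_mem hi)
    have ha0 := h0 a (Finset.mem_insert_self a s)
    have ha1 := h1 a (Finset.mem_insert_self a s)
    have hs : 0 ≤ ∑ i ∈ s, (1 - f i) := Finset.sum_nonneg fun i hi =>
      sub_nonneg.2 (h1 i (Finset.mem_insert_of_mem hi))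
    rw [Finset.sum_insert ha, Finset.prod_insert ha]
    nlinarith [mul_le_mul_of_nonneg_left ih' ha0, mul_nonneg (sub_nonneg.2 ha1) hs]

theorem sum_inv_sq_prime_gt_le {y : ℕ} (hy : 0 < y) (t : Finset Nat.Primes)
    (ht : ∀ p ∈ t, y < (p : ℕ)) : ∑ p ∈ t, (1 / (p : ℝ)) ^ 2 ≤ (y : ℝ)⁻¹ := by
  classical
  set u := t.image fun p : Nat.Primes => (p : ℕ) with hu
  obtain ⟨N, hN⟩ : ∃ N, ∀ m ∈ u, m ≤ N := ⟨u.sup id, fun m hm => Finset.le_sup (f := id) hm⟩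
  calc ∑ p ∈ t, (1 / (p : ℝ)) ^ 2 = ∑ m ∈ u, ((m : ℝ) ^ 2)⁻¹ := by
        refine Eq.trans ?_
          (Finset.sum_image fun p _ q _ h => Nat.Primes.coe_nat_injective h).symm
        exact Finset.sum_congr rfl fun p _ => by rw [one_div, inv_pow]
    _ ≤ ∑ m ∈ Finset.Ioc y (max y N), ((m : ℝ) ^ 2)⁻¹ := by
        refine Finset.sum_le_sum_of_subset_of_nonneg (fun m hm => ?_) fun _ _ _ => by positivity
        obtain ⟨p, hp, rfl⟩ := Finset.mem_image.1 hm
        exact Finset.mem_Ioc.2 ⟨ht p hp, (hN _ hm).trans (le_max_right _ _)⟩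
    _ ≤ (y : ℝ)⁻¹ - ((max y N : ℕ) : ℝ)⁻¹ := sum_Ioc_inv_sq_le_sub hy.ne' (le_max_left _ _)
    _ ≤ (y : ℝ)⁻¹ := sub_le_self _ (by positivity)

theorem one_div_prime_le_one (p : Nat.Primes) : 1 / (p : ℝ) ≤ 1 := by
  have : (1 : ℝ) ≤ p := by exact_mod_cast p.2.one_lt.le
  exact (div_le_one (by linarith)).2 this

theorem one_sub_localProb_zero_le (k : ℕ) (p : Nat.Primes) :
    1 - localProb k p 0 ≤ 2 ^ k * (k + 1) * (1 / (p : ℝ)) ^ 2 := by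
  rw [localProb_eq_sum (isLocalExpansion_zero k)]
  linarith [one_sub_le_sum_coprimeCoeff k (q := 1 / (p : ℝ)) (by positivity)
    (one_div_prime_le_one p)]

/-- Primes beyond `y ≥ n` do not divide `n`, so each omitted factor is `1 - O(1 / p ^ 2)`; the tail
sum of `1 / p ^ 2` is at most `1 / y`. -/
theorem abs_prod_localProb_sub_pk_le (k : ℕ) {n : ℕ} (hn : 1 ≤ n) {y : ℕ} (hy : n ≤ y) :
    |∏ p ∈ primesUpTo y, localProb k p (n.factorization p) - pk k n| ≤
      2 ^ k * (k + 1) * (y : ℝ)⁻¹ := by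
  classical
  set s := primesUpTo y with hs
  set f : Nat.Primes → ℝ := fun p => localProb k p (n.factorization p) with hf
  have hup := pk_le_prod k hn s
  have hlow : ∏ p ∈ s, f p - 2 ^ k * (k + 1) * (y : ℝ)⁻¹ ≤ pk k n := by
    refine ge_of_tendsto (hasProd_localProb k hn) ((Filter.eventually_ge_atTop s).mono fun t hst => ?_)
    have hgt : ∀ p ∈ t \ s, y < (p : ℕ) := fun p hp => by
      have := (Finset.mem_sdiff.1 hp).2
      rw [hs, mem_primesUpTo] at this
      omega
    rw [← Finset.prod_sdiff hst]
    have h1 := one_sub_sum_le_prod (t \ s) f (fun p _ => localProb_nonneg _ _ _)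
      fun p _ => localProb_le_one _ _ _
    have h2 : ∑ p ∈ t \ s, (1 - f p) ≤ 2 ^ k * (k + 1) * (y : ℝ)⁻¹ := by
      calc ∑ p ∈ t \ s, (1 - f p) ≤ ∑ p ∈ t \ s, 2 ^ k * (k + 1) * (1 / (p : ℝ)) ^ 2 := by
            refine Finset.sum_le_sum fun p hp => ?_
            have : n.factorization p = 0 :=
              Nat.factorization_eq_zero_of_lt (hy.trans_lt (hgt p hp))
            simp only [hf, this]
            exact one_sub_localProb_zero_le k p
        _ = 2 ^ k * (k + 1) * ∑ p ∈ t \ s, (1 / (p : ℝ)) ^ 2 := by rw [Finset.mul_sum]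
        _ ≤ _ := mul_le_mul_of_nonneg_left
          (sum_inv_sq_prime_gt_le (hn.trans hy) _ hgt) (by positivity)
    have h3 : 0 ≤ ∏ p ∈ s, f p := Finset.prod_nonneg fun p _ => localProb_nonneg _ _ _
    have h4 : ∏ p ∈ s, f p ≤ 1 := Finset.prod_le_one (fun p _ => localProb_nonneg _ _ _)
      fun p _ => localProb_le_one _ _ _
    have h5 : (0 : ℝ) ≤ 2 ^ k * (k + 1) * (y : ℝ)⁻¹ := by positivity
    have h6 := mul_le_mul_of_nonneg_right (by linarith :
      1 - 2 ^ k * (k + 1) * (y : ℝ)⁻¹ ≤ ∏ p ∈ t \ s, f p) h3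
    have h7 := mul_le_mul_of_nonneg_left h4 h5
    change _ ≤ (∏ p ∈ t \ s, f p) * ∏ p ∈ s, f p
    linarith
  rw [abs_of_nonneg (sub_nonneg.2 hup)]
  linarith

/-- Local expansions at all primes, whose coefficients are small in the Euler product sense. -/
theorem exists_localExpansions_prod_le (k n : ℕ) :
    ∃ (A : Nat.Primes → Finset (Fin k → ℕ)) (h : Nat.Primes → (Fin k → ℕ) → ℝ),
      (∀ p : Nat.Primes, IsLocalExpansion k (n.factorization p) (A p) (h p)) ∧
      ∃ C : ℝ, 0 ≤ C ∧ ∀ i : Fin k, ∀ y : ℕ, n ≤ y → 2 ≤ y →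
        ∏ p ∈ primesUpTo y,
          ∑ a ∈ A p, |h p a| * (1 / (p : ℝ)) ^ (∑ j ∈ Finset.univ.erase i, a j) ≤
        C * Real.log y ^ (k - 1) := by
  classical
  -- Explicit coefficients are needed only for `p > n`, where the exponent is `0`. The finitely many
  -- other primes may use any expansion, at the cost of the constant factors `M p`.
  have hex : ∀ p : Nat.Primes, ∃ Ah : Finset (Fin k → ℕ) × ((Fin k → ℕ) → ℝ),
      IsLocalExpansion k (n.factorization p) Ah.1 Ah.2 ∧ (n < (p : ℕ) →
        Ah = (Fintype.piFinset fun _ => Finset.range 2, coprimeCoeff)) := by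
    intro p
    by_cases hp : n < (p : ℕ)
    · refine ⟨(Fintype.piFinset fun _ => Finset.range 2, coprimeCoeff), ?_, fun _ => rfl⟩
      rw [Nat.factorization_eq_zero_of_lt hp]
      exact isLocalExpansion_zero k
    · obtain ⟨A, h, hA⟩ := exists_isLocalExpansion k (n.factorization p)
      exact ⟨(A, h), hA, fun h' => absurd h' hp⟩
  choose Ah hAh hAh0 using hex
  obtain ⟨C, hC0, hC⟩ := exists_prod_one_add_inv_prime_le
  set K : ℝ := 2 ^ k * (k + 1) with hK
  set M : Nat.Primes → ℝ := fun p =>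
    if n < (p : ℕ) then 1 else 1 + ∑ a ∈ (Ah p).1, |(Ah p).2 a| with hM
  have hM0 : ∀ p, 1 ≤ M p := fun p => by
    simp only [hM]
    split_ifs
    · exact le_rfl
    · exact le_add_of_nonneg_right (Finset.sum_nonneg fun _ _ => abs_nonneg _)
  refine ⟨fun p => (Ah p).1, fun p => (Ah p).2, hAh,
    (∏ p ∈ primesUpTo n, M p) * C ^ (k - 1) *
      Real.exp (K * ∑' p : Nat.Primes, (1 / (p : ℝ)) ^ 2),
    mul_nonneg (mul_nonneg (Finset.prod_nonneg fun p _ => zero_le_one.trans (hM0 p))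
      (by positivity)) (Real.exp_pos _).le, fun i y hny hy => ?_⟩
  have hlocal : ∀ p : Nat.Primes,
      ∑ a ∈ (Ah p).1, |(Ah p).2 a| * (1 / (p : ℝ)) ^ (∑ j ∈ Finset.univ.erase i, a j) ≤
        M p * (1 + 1 / (p : ℝ)) ^ (k - 1) * Real.exp (K * (1 / (p : ℝ)) ^ 2) := by
    intro p
    have hq0 : 0 ≤ 1 / (p : ℝ) := by positivity
    have hq1 := one_div_prime_le_one p
    have hKq : 0 ≤ K * (1 / (p : ℝ)) ^ 2 := by positivity
    have hexp : 1 + K * (1 / (p : ℝ)) ^ 2 ≤ Real.exp (K * (1 / (p : ℝ)) ^ 2) := by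
      rw [add_comm]; exact Real.add_one_le_exp _
    by_cases hp : n < (p : ℕ)
    · have h1 := sum_abs_coprimeCoeff_le i hq0 hq1
      have h2 : 1 + (k - 1 : ℕ) * (1 / (p : ℝ)) ≤ (1 + 1 / (p : ℝ)) ^ (k - 1) :=
        one_add_mul_le_pow (by linarith) _
      have h3 : 1 ≤ 1 + (k - 1 : ℕ) * (1 / (p : ℝ)) := le_add_of_nonneg_right (by positivity)
      simp only [hAh0 p hp, hM, if_pos hp, one_mul]
      -- With `q = 1 / p`, the bound `1 + (k - 1) * q + K * q ^ 2` is at most `(1 + (k - 1) * q) *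
      -- (1 + K * q ^ 2)`.
      refine h1.trans (le_trans ?_ (mul_le_mul h2 hexp (by positivity) (by positivity)))
      rw [← hK]
      nlinarith [mul_nonneg (sub_nonneg.2 h3) hKq]
    · have h1 : ∑ a ∈ (Ah p).1, |(Ah p).2 a| * (1 / (p : ℝ)) ^ (∑ j ∈ Finset.univ.erase i, a j) ≤
          M p := by
        simp only [hM, if_neg hp]
        refine le_trans (Finset.sum_le_sum fun a _ => ?_) (le_add_of_nonneg_left zero_le_one)
        exact mul_le_of_le_one_right (abs_nonneg _) (pow_le_one₀ hq0 hq1)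
      have h2 : 1 ≤ (1 + 1 / (p : ℝ)) ^ (k - 1) := one_le_pow₀ (by linarith)
      have h3 : 1 ≤ Real.exp (K * (1 / (p : ℝ)) ^ 2) := by linarith
      have h4 : 0 ≤ M p := zero_le_one.trans (hM0 p)
      refine h1.trans ?_
      rw [mul_assoc]
      exact le_mul_of_one_le_right h4 (one_le_mul_of_one_le_of_one_le h2 h3)
  refine (Finset.prod_le_prod (fun p _ => Finset.sum_nonneg fun a _ => by positivity)
    fun p _ => hlocal p).trans ?_
  rw [Finset.prod_mul_distrib, Finset.prod_mul_distrib, Finset.prod_pow, ← Real.exp_sum,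
    ← Finset.mul_sum]
  have hMprod : ∏ p ∈ primesUpTo y, M p = ∏ p ∈ primesUpTo n, M p := by
    symm
    refine Finset.prod_subset (fun p hp => mem_primesUpTo.2 ((mem_primesUpTo.1 hp).trans hny))
      fun p _ hp => ?_
    rw [mem_primesUpTo, not_le] at hp
    simp [hM, hp]
  have hmert : ∏ p ∈ primesUpTo y, (1 + 1 / (p : ℝ)) ≤ C * Real.log y := by
    rw [prod_primesUpTo y fun p => 1 + 1 / (p : ℝ)]
    exact hC y hy
  have hlog : 0 ≤ Real.log y := Real.log_natCast_nonneg y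
  have hM1 : 0 ≤ ∏ p ∈ primesUpTo n, M p :=
    Finset.prod_nonneg fun p _ => zero_le_one.trans (hM0 p)
  have hsum : ∑ p ∈ primesUpTo y, (1 / (p : ℝ)) ^ 2 ≤ ∑' p : Nat.Primes, (1 / (p : ℝ)) ^ 2 :=
    summable_prime_inv_sq.sum_le_tsum _ fun p _ => by positivity
  have hpow : (∏ p ∈ primesUpTo y, (1 + 1 / (p : ℝ))) ^ (k - 1) ≤
      C ^ (k - 1) * Real.log y ^ (k - 1) := by
    rw [← mul_pow]
    exact pow_le_pow_left₀ (Finset.prod_nonneg fun p _ => by positivity) hmert _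
  rw [hMprod]
  calc _ ≤ (∏ p ∈ primesUpTo n, M p) * (C ^ (k - 1) * Real.log y ^ (k - 1)) *
        Real.exp (K * ∑' p : Nat.Primes, (1 / (p : ℝ)) ^ 2) := by gcongr
    _ = _ := by ring

/-! ### The distribution of the least common multiple -/

theorem prod_eq_mul_lcm_iff {k n y : ℕ} (hn : 1 ≤ n) (hny : n ≤ y) {X : Fin k → ℕ}
    (hX0 : ∀ i, X i ≠ 0) (hXy : ∀ i, X i ≤ y) :
    ∏ i, X i = n * Finset.univ.lcm X ↔ ∀ p ∈ primesUpTo y, ∑ j, (X j).factorization p =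
      n.factorization p + Finset.univ.sup fun j => (X j).factorization p := by
  have hn0 : n ≠ 0 := by omega
  have hlcm : Finset.univ.lcm X ≠ 0 := by
    rw [Ne, Finset.lcm_eq_zero_iff]
    rintro ⟨i, -, hi⟩
    exact hX0 i hi
  have hprod : ∏ i, X i ≠ 0 := Finset.prod_ne_zero_iff.2 fun i _ => hX0 i
  have hl : ∀ p, (∏ i, X i).factorization p = ∑ j, (X j).factorization p := fun p =>
    Nat.factorization_prod_apply fun i _ => hX0 i
  have hr : ∀ p, (n * Finset.univ.lcm X).factorization p =
      n.factorization p + Finset.univ.sup fun j => (X j).factorization p := fun p => by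
    rw [Nat.factorization_mul hn0 hlcm, Finsupp.add_apply,
      Finset.factorization_lcm fun i _ => hX0 i]
  constructor
  · intro h p _
    rw [← hl, ← hr, h]
  · intro h
    refine Nat.eq_of_factorization_eq hprod (mul_ne_zero hn0 hlcm) fun p => ?_
    by_cases hp : p.Prime
    · by_cases hpy : p ≤ y
      · rw [hl, hr]
        exact h ⟨p, hp⟩ (mem_primesUpTo.2 hpy)
      · rw [not_le] at hpy
        have hz : ∀ m ≤ y, m.factorization p = 0 := fun m hm =>
          Nat.factorization_eq_zero_of_lt (hm.trans_lt hpy)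
        rw [hl, hr]
        simp only [hz _ hny, hz _ (hXy _), Finset.sum_const_zero, zero_add]
        exact (Nat.le_zero.1 (Finset.sup_le fun _ _ => le_rfl)).symm
    · rw [Nat.factorization_eq_zero_of_not_prime _ hp, Nat.factorization_eq_zero_of_not_prime _ hp]

/-- Only `n = ∏ X i / lcm X` can contribute. When the event holds, `n * t * x ^ k < ∏ X i ≤ x ^ k`
places this `n` in the range of summation. -/
theorem indicator_lcm_eq_sum {k x : ℕ} {t : ℝ} (ht : 0 < t) {X : Fin k → ℕ}
    (hX0 : ∀ i, X i ≠ 0) (hXx : ∀ i, X i ≤ x) (hx : 0 < x) :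
    (if ((Finset.univ.lcm X : ℕ) : ℝ) / (x : ℝ) ^ k > t then (1 : ℝ) else 0) =
      ∑ n ∈ Finset.Icc 1 ⌊1 / t⌋₊, if ∏ i, X i = n * Finset.univ.lcm X ∧
        (n : ℝ) * t * (x : ℝ) ^ k < ∏ i, (X i : ℝ) then 1 else 0 := by
  have hx' : (0 : ℝ) < (x : ℝ) ^ k := by positivity
  have hlcm : Finset.univ.lcm X ≠ 0 := by
    rw [Ne, Finset.lcm_eq_zero_iff]
    rintro ⟨i, -, hi⟩
    exact hX0 i hi
  have hprod : ∏ i, X i ≠ 0 := Finset.prod_ne_zero_iff.2 fun i _ => hX0 i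
  set l := Finset.univ.lcm X with hl
  obtain ⟨m, hm⟩ : l ∣ ∏ i, X i :=
    Finset.lcm_dvd fun i hi => Finset.dvd_prod_of_mem X hi
  rw [mul_comm] at hm
  have hm0 : 0 < m := Nat.pos_of_ne_zero fun h => hprod (by rw [hm, h, zero_mul])
  have hl0 : 0 < l := Nat.pos_of_ne_zero hlcm
  have hcast : (∏ i, (X i : ℝ)) = m * l := by exact_mod_cast hm
  have heq : ∀ n : ℕ, ∏ i, X i = n * l ↔ n = m := fun n => by
    rw [hm]
    exact ⟨fun h => (Nat.eq_of_mul_eq_mul_right hl0 h).symm, fun h => by rw [h]⟩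
  have hm' : (0 : ℝ) < m := by exact_mod_cast hm0
  have hiff : (m : ℝ) * t * (x : ℝ) ^ k < m * l ↔ t < l / (x : ℝ) ^ k := by
    rw [lt_div_iff₀ hx', mul_assoc, mul_lt_mul_iff_right₀ hm']
  have hsum : ∀ n ∈ Finset.Icc 1 ⌊1 / t⌋₊, (if ∏ i, X i = n * l ∧
      (n : ℝ) * t * (x : ℝ) ^ k < ∏ i, (X i : ℝ) then (1 : ℝ) else 0) =
      if n = m then (if t < l / (x : ℝ) ^ k then 1 else 0) else 0 := by
    intro n _
    simp only [heq, hcast]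
    by_cases h : n = m
    · subst h
      simp only [true_and, if_true, hiff]
    · simp [h]
  rw [Finset.sum_congr rfl hsum, Finset.sum_ite_eq']
  by_cases ht' : t < l / (x : ℝ) ^ k
  · have hle : (∏ i, (X i : ℝ)) ≤ (x : ℝ) ^ k := by
      calc (∏ i, (X i : ℝ)) ≤ ∏ _i : Fin k, (x : ℝ) :=
            Finset.prod_le_prod (fun i _ => by positivity) fun i _ => by exact_mod_cast hXx i
        _ = _ := by simp
    have h1 : (m : ℝ) * t * (x : ℝ) ^ k < 1 * (x : ℝ) ^ k := by
      rw [one_mul]; exact (hiff.2 ht').trans_le (hcast ▸ hle)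
    have h2 : (m : ℝ) * t < 1 := lt_of_mul_lt_mul_right h1 hx'.le
    have h3 : m ∈ Finset.Icc 1 ⌊1 / t⌋₊ :=
      Finset.mem_Icc.2 ⟨hm0, Nat.le_floor ((le_div_iff₀ ht).2 h2.le)⟩
    rw [if_pos ht', if_pos h3]
  · rw [if_neg ht']
    simp

/-- The cutoff `x + n` bounds both `n` and all `X i`, so larger primes impose no condition. -/
theorem lcmTail_eq_sum {k x : ℕ} (hx : 0 < x) {t : ℝ} (ht : 0 < t) :
    lcmTail k x t = ∑ n ∈ Finset.Icc 1 ⌊1 / t⌋₊,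
      localCount k x (primesUpTo (x + n)) (fun p => n.factorization p) (n * t) / (x : ℝ) ^ k := by
  classical
  rw [lcmTail, uniformTuple_real k hx, ← Finset.sum_div]
  congr 1
  simp only [localCount]
  rw [Finset.sum_comm]
  refine Finset.sum_congr rfl fun X hX => ?_
  have hX1 : ∀ i, 1 ≤ X i ∧ X i ≤ x := fun i =>
    Finset.mem_Icc.1 (Fintype.mem_piFinset.1 hX i)
  have hX0 : ∀ i, X i ≠ 0 := fun i => by have := (hX1 i).1; omega
  simp only [Set.mem_ofPred_eq]
  rw [indicator_lcm_eq_sum ht hX0 (fun i => (hX1 i).2) hx]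
  refine Finset.sum_congr rfl fun n hn => ?_
  simp only [prod_eq_mul_lcm_iff (y := x + n) (Finset.mem_Icc.1 hn).1 (Nat.le_add_left n x) hX0
    fun i => (hX1 i).2.trans (Nat.le_add_right x n)]

/-- Converts the logarithm of the cutoff `x + n` to `log x`, through `x + n ≤ x * (n + 1)` and `log
2 ≤ log x`. -/
theorem log_add_le (x n : ℕ) (hx : 2 ≤ x) :
    Real.log (x + n : ℕ) ≤ (1 + Real.log (n + 1) / Real.log 2) * Real.log x := by
  have hx2 : (2 : ℝ) ≤ x := by exact_mod_cast hx
  have hn : (0 : ℝ) ≤ n := by positivity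
  have hl2 : 0 < Real.log 2 := Real.log_pos one_lt_two
  have h1 : ((x + n : ℕ) : ℝ) ≤ x * (n + 1) := by push_cast; nlinarith
  have h2 := Real.log_le_log (by positivity) h1
  rw [Real.log_mul (by positivity) (by positivity)] at h2
  have h3 : Real.log 2 ≤ Real.log x := Real.log_le_log two_pos hx2
  have h4 : 0 ≤ Real.log ((n : ℝ) + 1) / Real.log 2 :=
    div_nonneg (Real.log_nonneg (by linarith)) hl2.le
  have h5 := mul_le_mul_of_nonneg_left h3 h4
  rw [div_mul_cancel₀ _ hl2.ne'] at h5
  linarith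

theorem exists_abs_localCount_sub_pk_le (k : ℕ) {n : ℕ} (hn : 1 ≤ n) {c : ℝ} (hc : 0 < c) :
    ∃ C : ℝ, ∀ x : ℕ, 2 ≤ x →
      |localCount k x (primesUpTo (x + n)) (fun p => n.factorization p) c / (x : ℝ) ^ k -
        hypVol k c * pk k n| ≤ C * ((x : ℝ)⁻¹ * Real.log x ^ (k - 1)) := by
  obtain ⟨A, h, hA, C, hC0, hC⟩ := exists_localExpansions_prod_le k n
  set b : ℝ := 1 + Real.log (n + 1) / Real.log 2 with hb
  have hl2 : 0 < Real.log 2 := Real.log_pos one_lt_two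
  -- The first summand is the lattice error over the `k` indices. The second is the Euler product
  -- tail `O(1 / x)`, put in the required form by `1 ≤ (log x / log 2) ^ (k - 1)`.
  refine ⟨k * (C * b ^ (k - 1)) + 2 ^ k * (k + 1) * (Real.log 2)⁻¹ ^ (k - 1), fun x hx => ?_⟩
  have hx' : (0 : ℝ) < x := by exact_mod_cast (by omega : 0 < x)
  have hlx : Real.log 2 ≤ Real.log x := Real.log_le_log two_pos (by exact_mod_cast hx)
  have h1 := abs_localCount_sub_le hA (by omega : 0 < x) (primesUpTo (x + n)) hc
  have h2 := abs_prod_localProb_sub_pk_le k hn (Nat.le_add_left n x)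
  have h3 : (x : ℝ)⁻¹ * ∑ i : Fin k, ∏ p ∈ primesUpTo (x + n),
      ∑ a ∈ A p, |h p a| * (1 / (p : ℝ)) ^ (∑ j ∈ Finset.univ.erase i, a j) ≤
      k * (C * b ^ (k - 1)) * ((x : ℝ)⁻¹ * Real.log x ^ (k - 1)) := by
    have h4 : ∀ i : Fin k, ∏ p ∈ primesUpTo (x + n),
        ∑ a ∈ A p, |h p a| * (1 / (p : ℝ)) ^ (∑ j ∈ Finset.univ.erase i, a j) ≤
        C * b ^ (k - 1) * Real.log x ^ (k - 1) := fun i => by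
      refine (hC i (x + n) (Nat.le_add_left n x) (by omega)).trans ?_
      rw [mul_assoc, ← mul_pow]
      exact mul_le_mul_of_nonneg_left
        (pow_le_pow_left₀ (Real.log_natCast_nonneg _) (log_add_le x n hx) _) hC0
    calc _ ≤ (x : ℝ)⁻¹ * ∑ _i : Fin k, C * b ^ (k - 1) * Real.log x ^ (k - 1) :=
          mul_le_mul_of_nonneg_left (Finset.sum_le_sum fun i _ => h4 i) (by positivity)
      _ = _ := by
          rw [Finset.sum_const, nsmul_eq_mul, Finset.card_univ, Fintype.card_fin]
          ring
  have h5 : |hypVol k c * ∏ p ∈ primesUpTo (x + n), localProb k p (n.factorization p) -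
      hypVol k c * pk k n| ≤
      2 ^ k * (k + 1) * (Real.log 2)⁻¹ ^ (k - 1) * ((x : ℝ)⁻¹ * Real.log x ^ (k - 1)) := by
    rw [← mul_sub, abs_mul, abs_of_nonneg (hypVol_nonneg k hc)]
    have h6 : 1 ≤ (Real.log 2)⁻¹ ^ (k - 1) * Real.log x ^ (k - 1) := by
      rw [← mul_pow]
      refine one_le_pow₀ ?_
      rw [inv_mul_eq_div, one_le_div hl2]
      exact hlx
    have h7 : (((x + n : ℕ) : ℝ))⁻¹ ≤ (x : ℝ)⁻¹ :=
      inv_anti₀ hx' (by push_cast; linarith [(Nat.cast_nonneg n : (0 : ℝ) ≤ n)])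
    calc _ ≤ 1 * (2 ^ k * (k + 1) * (((x + n : ℕ) : ℝ))⁻¹) :=
          mul_le_mul (hypVol_le_one k hc) h2 (abs_nonneg _) zero_le_one
      _ ≤ 2 ^ k * (k + 1) * (x : ℝ)⁻¹ * 1 := by
          rw [one_mul, mul_one]; gcongr
      _ ≤ 2 ^ k * (k + 1) * (x : ℝ)⁻¹ * ((Real.log 2)⁻¹ ^ (k - 1) * Real.log x ^ (k - 1)) :=
          mul_le_mul_of_nonneg_left h6 (by positivity)
      _ = _ := by ring
  refine (abs_sub_le _ _ _).trans ((add_le_add (h1.trans h3) h5).trans ?_)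
  rw [add_mul]

end LcmTuples

/-! ### The Euler product and the limit law with error term. -/

theorem theorem1p1 (k : ℕ) (hk : 2 ≤ k) :
    (∀ n : ℕ, 1 ≤ n →
      HasProd (fun p : Nat.Primes => LcmTuples.eulerFactor k p (n.factorization p))
        (LcmTuples.pk k n)) ∧
    (∀ t : ℝ, 0 < t → t ≤ 1 →
      ∃ C : ℝ, ∀ x : ℕ, 2 ≤ x →
        |LcmTuples.lcmTail k x t -
            ∑ n ∈ Finset.Icc 1 ⌊1 / t⌋₊,
              (∫ z in ((n : ℝ) * t)..1,
                (-Real.log z) ^ (k - 1) / (Nat.factorial (k - 1) : ℝ)) * LcmTuples.pk k n|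
          ≤ C * ((x : ℝ)⁻¹ * Real.log (x : ℝ) ^ (k - 1))) := by
  refine ⟨fun n hn => ?_, fun t ht _ => ?_⟩
  · simpa only [LcmTuples.localProb_eq_eulerFactor (by omega : 1 ≤ k)] using
      LcmTuples.hasProd_localProb k hn
  -- The condition `1 ≤ n` sits inside the existential so that constants can be chosen for all `n`
  -- at once; only finitely many are then summed, which gives `C` depending on `k` and `t`.
  · have hex : ∀ n : ℕ, ∃ C : ℝ, 1 ≤ n → ∀ x : ℕ, 2 ≤ x →
        |LcmTuples.localCount k x (LcmTuples.primesUpTo (x + n)) (fun p => n.factorization p)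
          (n * t) / (x : ℝ) ^ k - LcmTuples.hypVol k (n * t) * LcmTuples.pk k n| ≤
          C * ((x : ℝ)⁻¹ * Real.log x ^ (k - 1)) := by
      intro n
      rcases Nat.eq_zero_or_pos n with rfl | hn
      · exact ⟨0, fun h => absurd h (by norm_num)⟩
      · have hn' : (0 : ℝ) < n := by exact_mod_cast hn
        obtain ⟨C, hC⟩ := LcmTuples.exists_abs_localCount_sub_pk_le k hn (mul_pos hn' ht)
        exact ⟨C, fun _ => hC⟩
    choose C hC using hex
    refine ⟨∑ n ∈ Finset.Icc 1 ⌊1 / t⌋₊, C n, fun x hx => ?_⟩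
    rw [LcmTuples.lcmTail_eq_sum (by omega) ht, ← Finset.sum_sub_distrib, Finset.sum_mul]
    refine (Finset.abs_sum_le_sum_abs _ _).trans (Finset.sum_le_sum fun n hn => ?_)
    obtain ⟨hn1, hn2⟩ := Finset.mem_Icc.1 hn
    have hn' : (0 : ℝ) < n := by exact_mod_cast hn1
    have hnt : (n : ℝ) * t ≤ 1 :=
      (le_div_iff₀ ht).1 ((Nat.le_floor_iff (by positivity)).1 hn2)
    rw [LcmTuples.hypVol_eq_integral (k - 1) (mul_pos hn' ht) hnt, Nat.sub_add_cancel (by omega)]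
    exact hC n hn1 x hx
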